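/- **Setting.** Let $n\ge 1$; functions live on $\mathbb R^n$ with Lebesgue measure. For a measurable $f\ge 0$ let $\lambda_f(y)=|\{f>y\}|$ and $f^*(t)=\inf\{y:\lambda_f(y)\le t\}$; for a weight $w$ let $\lambda_f^w(y)=\int_{\{f>y\}}w$. A *quasi-Banach r.i. space* $X$ is a complete space of measurable functions (those with $\|f\|_X:=\||f|\|_X<\infty$), given by a functional $\|\cdot\|_X$ with values in $[0,\infty]$ on nonnegative measurable functions such that: $\|f\|_X=0$ iff $f=0$ a.e.; $\|cf\|_X=c\|f\|_X$ for $c\ge0$; $\|f+g\|_X\le K(\|f\|_X+\|g\|_X)$ for some constant $K$; $f\le g$ a.e. implies $\|f\|_X\le\|g\|_X$; $\|\chi_E\|_X<\infty$ if $|E|<\infty$; and $\|f\|_X=\|g\|_X$ if $\lambda_f=\lambda_g$. Its fundamental function is $\varphi_X(t)=\|\chi_E\|_X$, $|E|=t$. Its associate norm is $\|f\|_{X'}=\sup\{\int_{\mathbb R^n} fg : g\ge 0,\ \|g\|_X\le1\}$ for $f\ge0$, with $\varphi_{X'}(t)=\|\chi_E\|_{X'}$, $|E|=t$. The norm of the representation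 space $\overline{X'}$ on $(0,\infty)$ is $\|h\|_{\overline{X'}}=\|f\|_{X'}$ for any $f$ on $\mathbb R^n$ equimeasurable with $h$. Put $$\|f\|_{M^\infty(X)}=\sup_{s>0}\varphi_X(s)f^*(s).$$ Let $Mf(x)=\sup_{Q\ni x}\frac1{|Q|}\int_Q|f|$ be the Hardy–Littlewood maximal function (cubes $Q$ with sides parallel to the axes), and $M_\delta f=\big(M(|f|^{1/\delta})\big)^{\delta}$. For $p\ge 1$, $A_p$ is the class of weights $w$ (measurable, locally integrable, a.e. positive and finite) with $\|w\|_{A_p}<\infty$, where $\|w\|_{A_p}=\sup_Q\big(\frac1{|Q|}\int_Q w\big)\big(\frac1{|Q|}\int_Q w^{1-p'}\big)^{p-1}$, $p'=p/(p-1)$, if $p>1$, and $\|w\|_{A_1}$ is the least $C$ such that $Mw\le Cw$ a.e. **Theorem 3.17 (324).** Let $X$ be a quasi-Banach r.i. space such that (i) there is $C_1<\infty$ with $\varphi_{X'}(t)\le C_1\, t/\varphi_X(t)$ for all $t>0$; (ii) there are $0<\delta<1$ and $C_2<\infty$ with $\|M_\delta f\|_{M^\infty(X)}\le C_2\|f\|_X$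 for all measurable $f\ge 0$; (iii) there are $0<\mu<1$ and $C_3<\infty$ with $\big\|(1+\tfrac{\cdot}{s})^{-\mu}\big\|_{\overline{X'}}\le C_3\,\varphi_{X'}(s)$ for all $s>0$. Let $1\le p_0<\infty$ and let $\varphi:\mathbb R\to[0,\infty)$ be bounded on $(0,B)$ for every $B>0$. Then there is a constant $C<\infty$ such that, for all measurable $f,g\ge0$ on $\mathbb R^n$ which satisfy $$\sup_{y>0}\,y\,\lambda_g^w(y)^{1/p_0}\;\le\;\varphi(\|w\|_{A_{p_0}})\Big(\int_{\mathbb R^n}f^{p_0}\,w\Big)^{1/p_0}\qquad\text{for every } w\in A_{p_0},$$ one has $$\|g\|_{M^\infty(X)}\le C\,\|f\|_X .$$ -/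

import Mathlib

open MeasureTheory Set Filter Topology
open scoped ENNReal NNReal

namespace RIExtrapolation

noncomputable section

/-- The distribution function `λ_f(y) = ν {x | f x > y}` with respect to a measure `ν`. -/
def distribution {α : Type*} [MeasurableSpace α] (ν : Measure α) (f : α → ℝ≥0∞) (y : ℝ≥0∞) :
    ℝ≥0∞ :=
  ν {x | y < f x}

/-- The decreasing rearrangement `f^*(t) = inf {y | λ_f(y) ≤ t}`. -/
def decreasingRearrangement {α : Type*} [MeasurableSpace α] (ν : Measure α) (f : α → ℝ≥0∞)
    (t : ℝ≥0∞) : ℝ≥0∞ :=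
  sInf {y | distribution ν f y ≤ t}

/-- A quasi-Banach rearrangement invariant function space over `ℝⁿ` with Lebesgue measure, given
by its quasi-norm on nonnegative measurable functions; the norm of a real function `u` is the norm
of `|u|`, and the space consists of the functions whose norm is finite. -/
structure QuasiBanachRISpace (n : ℕ) where
  /-- the quasi-norm (only its values at measurable functions matter) -/
  norm : ((Fin n → ℝ) → ℝ≥0∞) → ℝ≥0∞
  norm_eq_zero_iff : ∀ f, Measurable f → (norm f = 0 ↔ f =ᵐ[volume] 0)
  norm_const_mul : ∀ (c : ℝ≥0) (f), Measurable f → norm (fun x => c * f x) = c * norm f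
  quasi_triangle : ∃ K : ℝ≥0, ∀ f g, Measurable f → Measurable g →
    norm (fun x => f x + g x) ≤ K * (norm f + norm g)
  /-- the lattice (ideal) property -/
  mono : ∀ f g, Measurable f → Measurable g → f ≤ᵐ[volume] g → norm f ≤ norm g
  norm_indicator_lt_top : ∀ E : Set (Fin n → ℝ), MeasurableSet E → volume E < ∞ →
    norm (E.indicator 1) < ∞
  /-- equimeasurable functions have the same norm -/
  rearrangement_invariant : ∀ f g, Measurable f → Measurable g →
    (∀ y, distribution volume f y = distribution volume g y) → norm f = norm g
  complete : ∀ u : ℕ → (Fin n → ℝ) → ℝ, (∀ k, Measurable (u k)) →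
    (∀ k, norm (fun x => ‖u k x‖ₑ) < ∞) →
    (∀ ε : ℝ≥0∞, 0 < ε → ∃ N, ∀ i ≥ N, ∀ j ≥ N, norm (fun x => ‖u i x - u j x‖ₑ) ≤ ε) →
    ∃ v : (Fin n → ℝ) → ℝ, Measurable v ∧ norm (fun x => ‖v x‖ₑ) < ∞ ∧
      Tendsto (fun k => norm (fun x => ‖u k x - v x‖ₑ)) atTop (𝓝 0)

variable {n : ℕ}

/-- The norm of the associate space `X'`: `‖f‖_{X'} = sup {∫ f g | ‖g‖_X ≤ 1}`. -/
def associateNorm (ρ : ((Fin n → ℝ) → ℝ≥0∞) → ℝ≥0∞) (f : (Fin n → ℝ) → ℝ≥0∞) : ℝ≥0∞ :=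
  ⨆ (g : (Fin n → ℝ) → ℝ≥0∞) (_ : Measurable g) (_ : ρ g ≤ 1), ∫⁻ x, f x * g x

/-- The fundamental function `φ(t) = ‖χ_E‖`, `|E| = t`. For a rearrangement invariant norm all
such sets `E` give the same value, so that the supremum just picks this value. -/
def fundamentalFunction (ρ : ((Fin n → ℝ) → ℝ≥0∞) → ℝ≥0∞) (t : ℝ≥0∞) : ℝ≥0∞ :=
  ⨆ (E : Set (Fin n → ℝ)) (_ : MeasurableSet E) (_ : volume E = t), ρ (E.indicator 1)

/-- The norm of the representation space on `(0, ∞)`: `‖h‖` is the norm of any function on `ℝⁿ`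
which is equimeasurable with `h`. For a rearrangement invariant norm all such functions give the
same value, so that the supremum just picks this value; in particular `‖f‖_X = ‖f^*‖`. -/
def representationNorm (ρ : ((Fin n → ℝ) → ℝ≥0∞) → ℝ≥0∞) (h : ℝ → ℝ≥0∞) : ℝ≥0∞ :=
  ⨆ (f : (Fin n → ℝ) → ℝ≥0∞) (_ : Measurable f)
    (_ : ∀ y, distribution volume f y = distribution (volume.restrict (Ioi (0 : ℝ))) h y), ρ f

/-- The Marcinkiewicz type quasi-norm `‖f‖_{M^∞(X)} = sup_{s > 0} φ_X(s) f^*(s)`. -/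
def marcinkiewiczNorm (X : QuasiBanachRISpace n) (f : (Fin n → ℝ) → ℝ≥0∞) : ℝ≥0∞ :=
  ⨆ (s : ℝ≥0) (_ : 0 < s), fundamentalFunction X.norm s * decreasingRearrangement volume f s

/-- The (uncentered) Hardy-Littlewood maximal operator. The norm of `Fin n → ℝ` is the sup norm,
so its balls are exactly the cubes with sides parallel to the axes. -/
def maximalFunction (f : (Fin n → ℝ) → ℝ≥0∞) (x : Fin n → ℝ) : ℝ≥0∞ :=
  ⨆ (c : Fin n → ℝ) (r : ℝ) (_ : 0 < r) (_ : x ∈ Metric.closedBall c r),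
    ⨍⁻ y in Metric.closedBall c r, f y ∂volume

/-- `M_δ f = (M (f ^ (1 / δ))) ^ δ`. -/
def maximalPower (δ : ℝ) (f : (Fin n → ℝ) → ℝ≥0∞) (x : Fin n → ℝ) : ℝ≥0∞ :=
  maximalFunction (fun y => f y ^ (1 / δ)) x ^ δ

/-- The Muckenhoupt constant of `w`: for `p = 1` the least `C` with `M w ≤ C w` a.e., and for
`p > 1` the supremum over cubes of `(⨍ w) (⨍ w ^ (1 - p'))^(p - 1)`, with `1 - p' = -1 / (p - 1)`. -/
def muckenhouptConst (p : ℝ) (w : (Fin n → ℝ) → ℝ≥0∞) : ℝ≥0∞ :=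
  if p = 1 then sInf {C : ℝ≥0∞ | ∀ᵐ x, maximalFunction w x ≤ C * w x}
  else ⨆ (c : Fin n → ℝ) (r : ℝ) (_ : 0 < r),
    (⨍⁻ x in Metric.closedBall c r, w x ∂volume) *
      (⨍⁻ x in Metric.closedBall c r, w x ^ (-(1 / (p - 1))) ∂volume) ^ (p - 1)

/-- The Muckenhoupt class `A_p`: weights (measurable, a.e. positive and finite, integrable on
cubes) with finite Muckenhoupt constant. -/
structure IsMuckenhoupt (p : ℝ) (w : (Fin n → ℝ) → ℝ≥0∞) : Prop where
  measurable : Measurable w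
  pos : ∀ᵐ x, 0 < w x
  lt_top : ∀ᵐ x, w x < ∞
  locally_integrable : ∀ (c : Fin n → ℝ) (r : ℝ), ∫⁻ x in Metric.closedBall c r, w x < ∞
  const_lt_top : muckenhouptConst p w < ∞

/-- The norm of `L^p(w)`. -/
def strongNorm (p : ℝ) (w f : (Fin n → ℝ) → ℝ≥0∞) : ℝ≥0∞ :=
  (∫⁻ x, f x ^ p * w x) ^ (1 / p)

/-- The norm of `L^{p,∞}(w)`: `sup_{y > 0} y λ_g^w(y)^{1/p}`. -/
def weakNorm (p : ℝ) (w g : (Fin n → ℝ) → ℝ≥0∞) : ℝ≥0∞ :=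
  ⨆ (y : ℝ≥0) (_ : 0 < y), y * distribution (volume.withDensity w) g y ^ (1 / p)

/-- The weighted weak type inequality
`‖g‖_{L^{p,∞}(w)} ≤ φ(‖w‖_{A_p}) ‖f‖_{L^p(w)}` for every `w ∈ A_p`. -/
def WeakExtrapolationPair (p : ℝ) (φ : ℝ → ℝ≥0) (f g : (Fin n → ℝ) → ℝ≥0∞) : Prop :=
  ∀ w : (Fin n → ℝ) → ℝ≥0∞, IsMuckenhoupt p w →
    weakNorm p w g ≤ φ (muckenhouptConst p w).toReal * strongNorm p w f

end

end RIExtrapolation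

/-!
# Weak type extrapolation to rearrangement invariant spaces

Fix `f` with `0 < ‖f‖_X < ∞` and a level `y`, and let `E ⊆ {g > y}` have finite measure `T`. The
hypothesis on the pair `(f, g)` is tested with the single weight `w = u ^ (1 - p₀) v`, where
`u = M_δ f` and `v = (M χ_E) ^ μ`. Both `u` and `v` are `A₁` weights with constants depending only
on `n`, `δ`, `μ`, by the Coifman–Rochberg theorem (`maximalFunction_rpow_maximalFunction_le`), so
that `w ∈ A_{p₀}` with a constant independent of `f` and `E` (`isMuckenhoupt_rpow_mul`).

* Since `f ≤ M_δ f` almost everywhere, `∫ f ^ p₀ w ≤ ∫ f v`. By the weak type `(1, 1)` inequality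
  the rearrangement of `v` is at most a multiple of `(1 + t / T) ^ (-μ)`
  (`distribution_maximalFunction_indicator_rpow_le`). The Hardy–Littlewood inequality and duality
  (`lintegral_mul_le_representationNorm`) together with (iii) and (i) therefore give
  `∫ f ^ p₀ w ≲ T q`, where `q = ‖f‖_X / φ_X(T)`.
* By (ii) and the doubling property of `φ_X` (`fundamentalFunction_le_half`) there is a constant `D`
  such that `{M_δ f > D q}` has measure at most `T / 2`. On the rest of `E` the weight is at least
  `(D q) ^ (1 - p₀)`, because `v = 1` almost everywhere on `E`. Hence
  `∫_{g > y} w ≥ (D q) ^ (1 - p₀) T / 2`.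

Inserting the two bounds in the weak type inequality yields `y ^ p₀ ≲ q ^ p₀`, that is,
`y φ_X(T) ≲ ‖f‖_X` (`le_of_weakExtrapolationPair`). As `T` may be taken larger than any
`s < |{g > y}|`, this is the bound of `φ_X(s) g^*(s)`.
-/

namespace RIExtrapolation

variable {n : ℕ}

/-! ### The Hardy–Littlewood maximal function -/

lemma volume_closedBall_smul (c c' : Fin n → ℝ) {k r : ℝ} (hk : 0 ≤ k) (hr : 0 ≤ r) :
    volume (Metric.closedBall c (k * r)) =
      ENNReal.ofReal k ^ n * volume (Metric.closedBall c' r) := by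
  rw [Real.volume_pi_closedBall _ (by positivity), Real.volume_pi_closedBall _ hr,
    ← ENNReal.ofReal_pow hk, ← ENNReal.ofReal_mul (by positivity), Fintype.card_fin, ← mul_pow]
  ring_nf

lemma setLAverage_le_maximalFunction (h : (Fin n → ℝ) → ℝ≥0∞) {c x : Fin n → ℝ} {r : ℝ}
    (hr : 0 < r) (hx : x ∈ Metric.closedBall c r) :
    ⨍⁻ y in Metric.closedBall c r, h y ∂volume ≤ maximalFunction h x :=
  le_iSup₂_of_le c r (le_iSup₂_of_le hr hx le_rfl)

lemma setLIntegral_le_maximalFunction_mul (h : (Fin n → ℝ) → ℝ≥0∞) {c x : Fin n → ℝ} {r : ℝ}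
    (hr : 0 < r) (hx : x ∈ Metric.closedBall c r) :
    ∫⁻ y in Metric.closedBall c r, h y ≤
      maximalFunction h x * volume (Metric.closedBall c r) := by
  have := setLAverage_le_maximalFunction h hr hx
  rw [setLAverage_eq] at this
  exact (ENNReal.div_le_iff (Metric.measure_closedBall_pos volume c hr).ne'
    measure_closedBall_lt_top.ne).1 this

lemma maximalFunction_le_iff {h : (Fin n → ℝ) → ℝ≥0∞} {x : Fin n → ℝ} {a : ℝ≥0∞} :
    maximalFunction h x ≤ a ↔ ∀ (c : Fin n → ℝ) (r : ℝ), 0 < r → x ∈ Metric.closedBall c r →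
      ∫⁻ y in Metric.closedBall c r, h y ≤ a * volume (Metric.closedBall c r) := by
  simp only [maximalFunction, iSup_le_iff, setLAverage_eq]
  refine forall_congr' fun c => forall_congr' fun r => forall_congr' fun hr =>
    forall_congr' fun _ => ?_
  exact ENNReal.div_le_iff (Metric.measure_closedBall_pos volume c hr).ne'
    measure_closedBall_lt_top.ne

lemma lt_maximalFunction_iff {h : (Fin n → ℝ) → ℝ≥0∞} {x : Fin n → ℝ} {a : ℝ≥0∞} :
    a < maximalFunction h x ↔ ∃ (c : Fin n → ℝ) (r : ℝ), 0 < r ∧ x ∈ Metric.closedBall c r ∧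
      a * volume (Metric.closedBall c r) < ∫⁻ y in Metric.closedBall c r, h y := by
  rw [← not_le, maximalFunction_le_iff]
  push Not
  rfl

lemma maximalFunction_mono {h k : (Fin n → ℝ) → ℝ≥0∞} (hk : ∀ x, h x ≤ k x) (x : Fin n → ℝ) :
    maximalFunction h x ≤ maximalFunction k x :=
  maximalFunction_le_iff.2 fun _ _ hr hx =>
    (lintegral_mono hk).trans (setLIntegral_le_maximalFunction_mul k hr hx)

lemma maximalFunction_add_le {h k : (Fin n → ℝ) → ℝ≥0∞} (hh : Measurable h) (x : Fin n → ℝ) :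
    maximalFunction (fun y => h y + k y) x ≤ maximalFunction h x + maximalFunction k x := by
  refine maximalFunction_le_iff.2 fun c r hr hx => ?_
  rw [lintegral_add_left hh, add_mul]
  exact add_le_add (setLIntegral_le_maximalFunction_mul h hr hx)
    (setLIntegral_le_maximalFunction_mul k hr hx)

/-- The uncentered maximal function is lower semicontinuous: a cube on which the average exceeds
`a` can be enlarged slightly, so that it contains a neighbourhood of each of its points. -/
lemma lowerSemicontinuous_maximalFunction (h : (Fin n → ℝ) → ℝ≥0∞) :
    LowerSemicontinuous (maximalFunction h) := by
  intro x a ha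
  obtain ⟨c, r, hr, hx, hlt⟩ := lt_maximalFunction_iff.1 ha
  have ha' : a ≠ ∞ := ha.ne_top
  have hcont : Continuous fun t : ℝ => a * ENNReal.ofReal ((2 * t) ^ n) :=
    (ENNReal.continuous_const_mul ha').comp (ENNReal.continuous_ofReal.comp (by fun_prop))
  rw [Real.volume_pi_closedBall _ hr.le, Fintype.card_fin] at hlt
  have hev : ∀ᶠ t in 𝓝[>] r, a * ENNReal.ofReal ((2 * t) ^ n) <
      ∫⁻ y in Metric.closedBall c r, h y :=
    (hcont.tendsto r).eventually_lt_const hlt |>.filter_mono nhdsWithin_le_nhds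
  obtain ⟨t, ht, hrt⟩ := (hev.and self_mem_nhdsWithin).exists
  have hrt : r < t := hrt
  filter_upwards [Metric.isOpen_ball.mem_nhds
    (Metric.closedBall_subset_ball hrt hx)] with z hz
  refine lt_maximalFunction_iff.2 ⟨c, t, hr.trans hrt, Metric.ball_subset_closedBall hz, ?_⟩
  rw [Real.volume_pi_closedBall _ (hr.trans hrt).le, Fintype.card_fin]
  exact ht.trans_le (lintegral_mono_set (Metric.closedBall_subset_closedBall hrt.le))

lemma measurable_maximalFunction (h : (Fin n → ℝ) → ℝ≥0∞) : Measurable (maximalFunction h) :=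
  (lowerSemicontinuous_maximalFunction h).measurable

lemma maximalFunction_pos {h : (Fin n → ℝ) → ℝ≥0∞} (hm : Measurable h)
    (h0 : ¬ h =ᵐ[volume] 0) (x : Fin n → ℝ) : 0 < maximalFunction h x := by
  rw [pos_iff_ne_zero]
  intro hx
  apply h0
  have hz : ∀ k : ℕ, ∀ᵐ y ∂volume.restrict (Metric.closedBall x (k + 1)), h y = 0 := by
    intro k
    have := setLIntegral_le_maximalFunction_mul h (c := x) (x := x) (r := k + 1) (by positivity)
      (Metric.mem_closedBall_self (by positivity))
    rw [hx, zero_mul, nonpos_iff_eq_zero] at this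
    exact (lintegral_eq_zero_iff hm).1 this
  have hU : (⋃ k : ℕ, Metric.closedBall x ((k : ℝ) + 1)) = univ := by
    refine eq_univ_of_forall fun y => ?_
    obtain ⟨k, hk⟩ := exists_nat_ge (dist y x)
    exact mem_iUnion.2 ⟨k, Metric.mem_closedBall.2 (by linarith)⟩
  have := (ae_restrict_iUnion_iff (μ := volume)
    (fun k : ℕ => Metric.closedBall x ((k : ℝ) + 1)) (fun y => h y = 0)).2 hz
  rw [hU, Measure.restrict_univ] at this
  exact this

lemma ae_le_maximalFunction {h : (Fin n → ℝ) → ℝ≥0∞} (hm : Measurable h) :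
    ∀ᵐ x, h x ≤ maximalFunction h x := by
  -- The differentiation theorem needs an integrable function, hence the truncations.
  let u : ℕ → (Fin n → ℝ) → ℝ≥0∞ := fun N =>
    (Metric.closedBall 0 N).indicator fun x => min (h x) N
  have hu : ∀ N, Measurable (u N) := fun N =>
    (hm.min measurable_const).indicator Metric.isClosed_closedBall.measurableSet
  have hu_int : ∀ N, ∫⁻ x, u N x ≠ ∞ := by
    intro N
    rw [lintegral_indicator Metric.isClosed_closedBall.measurableSet]
    refine ne_of_lt ((setLIntegral_mono measurable_const fun x _ => min_le_right _ _).trans_lt ?_)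
    rw [setLIntegral_const]
    exact ENNReal.mul_lt_top (by simp) measure_closedBall_lt_top
  have key : ∀ N, ∀ᵐ x, u N x ≤ maximalFunction (u N) x := by
    intro N
    filter_upwards [(Besicovitch.vitaliFamily (volume : Measure (Fin n → ℝ))).ae_tendsto_lintegral_div
      (hu N).aemeasurable (hu_int N)] with x hx
    refine le_of_tendsto (hx.comp (Besicovitch.tendsto_filterAt volume x)) ?_
    filter_upwards [self_mem_nhdsWithin] with r hr
    have := setLAverage_le_maximalFunction (u N) hr (Metric.mem_closedBall_self (x := x) (le_of_lt hr))
    rwa [setLAverage_eq] at this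
  filter_upwards [ae_all_iff.2 key] with x hx
  by_contra! hlt
  obtain ⟨N₁, hN₁⟩ := ENNReal.exists_nat_gt hlt.ne_top
  obtain ⟨N₂, hN₂⟩ := exists_nat_ge ‖x‖
  have hmem : x ∈ Metric.closedBall (0 : Fin n → ℝ) (max N₁ N₂ : ℕ) := by
    rw [mem_closedBall_zero_iff]
    exact hN₂.trans (by exact_mod_cast le_max_right _ _)
  have h1 := (hx (max N₁ N₂)).trans (maximalFunction_mono (k := h) (fun y => by
    by_cases hy : y ∈ Metric.closedBall (0 : Fin n → ℝ) (max N₁ N₂ : ℕ)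
    · simp only [u, indicator_of_mem hy]; exact min_le_left _ _
    · simp only [u, indicator_of_notMem hy]; exact zero_le) x)
  simp only [u, indicator_of_mem hmem] at h1
  refine absurd h1 (not_le.2 (lt_min hlt (hN₁.trans_le ?_)))
  exact_mod_cast le_max_left _ _

/-- The weak type `(1, 1)` inequality, by the Vitali covering lemma. -/
lemma mul_distribution_maximalFunction_le (hn : 1 ≤ n) (h : (Fin n → ℝ) → ℝ≥0∞) (y : ℝ≥0∞) :
    y * distribution volume (maximalFunction h) y ≤ 5 ^ n * ∫⁻ x, h x := by
  rcases eq_or_ne y 0 with rfl | hy0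
  · simp
  rcases eq_or_ne y ∞ with rfl | hy
  · simp [distribution]
  rcases eq_or_ne (∫⁻ x, h x) ∞ with hI | hI
  · simp [hI]
  let t : Set ((Fin n → ℝ) × ℝ) := {p | 0 < p.2 ∧
    y * volume (Metric.closedBall p.1 p.2) < ∫⁻ z in Metric.closedBall p.1 p.2, h z}
  have hn' : n ≠ 0 := by omega
  -- The radii are bounded, because the volumes are at most `(∫ h) / y`.
  have hR : ∃ R : ℝ, ∀ p ∈ t, p.2 ≤ R := by
    refine ⟨max 1 ((∫⁻ x, h x) / y).toReal, fun p hp => ?_⟩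
    rcases le_total p.2 1 with h1 | h1
    · exact h1.trans (le_max_left _ _)
    refine le_trans ?_ (le_max_right _ _)
    have h2 : volume (Metric.closedBall p.1 p.2) ≤ (∫⁻ x, h x) / y := by
      rw [ENNReal.le_div_iff_mul_le (Or.inl hy0) (Or.inl hy), mul_comm]
      exact hp.2.le.trans (setLIntegral_le_lintegral _ _)
    rw [Real.volume_pi_closedBall _ hp.1.le, Fintype.card_fin,
      ENNReal.ofReal_le_iff_le_toReal (ENNReal.div_ne_top hI hy0)] at h2
    refine le_trans ?_ h2
    calc p.2 ≤ 2 * p.2 := by linarith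
      _ ≤ (2 * p.2) ^ n := le_self_pow₀ (by linarith) hn'
  obtain ⟨R, hR⟩ := hR
  obtain ⟨u, hut, hdisj, hcov⟩ := Vitali.exists_disjoint_subfamily_covering_enlargement_closedBall
    t Prod.fst Prod.snd R hR 5 (by norm_num)
  have hcount : u.Countable := hdisj.countable_of_nonempty_interior fun p hp =>
    (Metric.nonempty_ball.2 (hut hp).1).mono Metric.ball_subset_interior_closedBall
  have hsub : {x | y < maximalFunction h x} ⊆ ⋃ p ∈ u, Metric.closedBall p.1 (5 * p.2) := by
    intro x hx
    obtain ⟨c, r, hr, hxc, hlt⟩ := lt_maximalFunction_iff.1 hx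
    obtain ⟨b, hb, hsub⟩ := hcov (c, r) ⟨hr, hlt⟩
    exact mem_iUnion₂.2 ⟨b, hb, hsub hxc⟩
  calc y * distribution volume (maximalFunction h) y
      ≤ y * ∑' p : u, volume (Metric.closedBall p.1.1 (5 * p.1.2)) := by
        gcongr
        exact (measure_mono hsub).trans (measure_biUnion_le _ hcount _)
    _ = ∑' p : u, 5 ^ n * (y * volume (Metric.closedBall p.1.1 p.1.2)) := by
        rw [← ENNReal.tsum_mul_left]
        refine tsum_congr fun p => ?_
        rw [volume_closedBall_smul p.1.1 p.1.1 (by norm_num) (hut p.2).1.le,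
          ENNReal.ofReal_ofNat]
        ring
    _ ≤ ∑' p : u, 5 ^ n * ∫⁻ z in Metric.closedBall p.1.1 p.1.2, h z :=
        ENNReal.tsum_le_tsum fun p => by gcongr; exact (hut p.2).2.le
    _ = 5 ^ n * ∫⁻ z in ⋃ p ∈ u, Metric.closedBall p.1 p.2, h z := by
        rw [ENNReal.tsum_mul_left, lintegral_biUnion hcount
          (fun p _ => Metric.isClosed_closedBall.measurableSet) hdisj]
    _ ≤ 5 ^ n * ∫⁻ x, h x := by gcongr; exact Measure.restrict_le_self

/-! ### Powers of maximal functions as `A₁` weights -/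

/-- The constant in Kolmogorov's inequality `lintegral_rpow_le_of_weak_type`. -/
noncomputable def kolmogorovConst (δ : ℝ) : ℝ≥0∞ :=
  ∑' j : ℕ, (2 ^ (j + 1)) ^ δ * (2 ^ j)⁻¹

lemma kolmogorovConst_lt_top {δ : ℝ} (h1 : δ < 1) : kolmogorovConst δ < ∞ := by
  have : ∀ j : ℕ, ((2 : ℝ≥0∞) ^ (j + 1)) ^ δ * (2 ^ j)⁻¹ = 2 ^ δ * ((2 : ℝ≥0∞) ^ (δ - 1)) ^ j := by
    intro j
    simp only [← ENNReal.rpow_natCast, ← ENNReal.rpow_mul, ← ENNReal.rpow_neg]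
    rw [← ENNReal.rpow_add _ _ (by simp) (by simp), ← ENNReal.rpow_add _ _ (by simp) (by simp)]
    congr 1
    push_cast
    ring
  rw [kolmogorovConst, tsum_congr this, ENNReal.tsum_mul_left, ENNReal.tsum_geometric]
  have h2 : (2 : ℝ≥0∞) ^ (δ - 1) < 1 :=
    ENNReal.rpow_lt_one_of_one_lt_of_neg (by norm_num) (by linarith)
  refine ENNReal.mul_lt_top (ENNReal.rpow_ne_top_of_ne_zero (by simp) (by simp)).lt_top ?_
  rw [ENNReal.inv_lt_top]
  exact tsub_pos_of_lt h2

/-- Only the term with `2 ^ j t < k ≤ 2 ^ (j + 1) t` is needed when `t < k < ∞`. -/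
lemma rpow_le_dyadic_sum {δ : ℝ} (h0 : 0 < δ) {t k : ℝ≥0∞} (ht0 : t ≠ 0) (ht : t ≠ ∞) :
    k ^ δ ≤ t ^ δ * (1 + ∑' j : ℕ, (2 ^ (j + 1)) ^ δ * {z | 2 ^ j * t < z}.indicator 1 k) := by
  rcases eq_or_ne k ∞ with rfl | hk
  · have : ∑' j : ℕ, ((2 : ℝ≥0∞) ^ (j + 1)) ^ δ * {z | 2 ^ j * t < z}.indicator 1 ∞ = ∞ := by
      refine top_unique ((ENNReal.tsum_const_eq_top_of_ne_zero (α := ℕ) one_ne_zero).ge.trans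
        (ENNReal.tsum_le_tsum fun j => ?_))
      have : ∞ ∈ {z | 2 ^ j * t < z} := ENNReal.mul_lt_top (by simp) ht.lt_top
      rw [indicator_of_mem this, Pi.one_apply, mul_one]
      exact ENNReal.one_le_rpow (one_le_pow₀ (by norm_num)) h0
    rw [this, add_top, ENNReal.mul_top]
    · exact le_top
    · simp [ht0, ht, h0]
  rcases le_or_gt k t with hkt | hkt
  · calc k ^ δ ≤ t ^ δ * 1 := by rw [mul_one]; gcongr
      _ ≤ _ := by gcongr; exact le_self_add
  have hex : ∃ m : ℕ, k ≤ 2 ^ m * t := by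
    obtain ⟨m, hm⟩ := ENNReal.exists_nat_gt (ENNReal.div_ne_top hk ht0)
    refine ⟨m, (ENNReal.div_le_iff ht0 ht).1 (hm.le.trans ?_)⟩
    exact_mod_cast (Nat.lt_two_pow_self).le
  classical
  obtain ⟨j, hj⟩ : ∃ j, Nat.find hex = j + 1 := by
    refine Nat.exists_eq_succ_of_ne_zero fun h => ?_
    have := Nat.find_spec hex
    rw [h, pow_zero, one_mul] at this
    exact absurd this (not_le.2 hkt)
  have hle : k ≤ 2 ^ (j + 1) * t := hj ▸ Nat.find_spec hex
  have hlt : 2 ^ j * t < k := not_le.1 (Nat.find_min hex (by omega))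
  calc k ^ δ ≤ (2 ^ (j + 1) * t) ^ δ := by gcongr
    _ = t ^ δ * ((2 ^ (j + 1)) ^ δ * {z | 2 ^ j * t < z}.indicator 1 k) := by
        rw [indicator_of_mem (by exact hlt), Pi.one_apply, mul_one,
          ENNReal.mul_rpow_of_nonneg _ _ h0.le, mul_comm]
    _ ≤ _ := by
        gcongr
        exact (ENNReal.le_tsum (f := fun j : ℕ =>
          ((2 : ℝ≥0∞) ^ (j + 1)) ^ δ * {z | 2 ^ j * t < z}.indicator 1 k) j).trans le_add_self

/-- Kolmogorov's inequality: weak `L¹` functions are locally in `L^δ` for `δ < 1`. The level `t` is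
free; it is applied with `t` comparable to `N / ν univ`. -/
lemma lintegral_rpow_le_of_weak_type {α : Type*} [MeasurableSpace α] {ν : Measure α}
    {k : α → ℝ≥0∞} (hk : Measurable k) {N : ℝ≥0∞} (hN : ∀ y, y * distribution ν k y ≤ N)
    {δ : ℝ} (h0 : 0 < δ) {t : ℝ≥0∞} (ht0 : t ≠ 0) (ht : t ≠ ∞) :
    ∫⁻ x, k x ^ δ ∂ν ≤ t ^ δ * (ν univ + kolmogorovConst δ * (N / t)) := by
  have hms : ∀ j : ℕ, MeasurableSet {z : ℝ≥0∞ | 2 ^ j * t < z} := fun j => measurableSet_Ioi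
  have hmi : ∀ j : ℕ, Measurable fun x =>
      {z : ℝ≥0∞ | 2 ^ j * t < z}.indicator (1 : ℝ≥0∞ → ℝ≥0∞) (k x) := fun j =>
    (measurable_one.indicator (hms j)).comp hk
  calc ∫⁻ x, k x ^ δ ∂ν
      ≤ ∫⁻ x, t ^ δ * (1 + ∑' j : ℕ, (2 ^ (j + 1)) ^ δ *
          {z | 2 ^ j * t < z}.indicator 1 (k x)) ∂ν :=
        lintegral_mono fun x => rpow_le_dyadic_sum h0 ht0 ht
    _ = t ^ δ * (ν univ + ∑' j : ℕ, (2 ^ (j + 1)) ^ δ * distribution ν k (2 ^ j * t)) := by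
        rw [lintegral_const_mul' _ _ (ENNReal.rpow_ne_top_of_nonneg h0.le ht),
          lintegral_add_left measurable_const, lintegral_one,
          lintegral_tsum fun j => ((hmi j).const_mul _).aemeasurable]
        congr 3
        refine funext fun j => ?_
        rw [lintegral_const_mul _ (hmi j)]
        congr 1
        exact lintegral_indicator_one (hk (hms j))
    _ ≤ t ^ δ * (ν univ + ∑' j : ℕ, (2 ^ (j + 1)) ^ δ * (2 ^ j)⁻¹ * (N / t)) := by
        gcongr _ * (_ + ?_)
        refine ENNReal.tsum_le_tsum fun j => ?_
        rw [mul_assoc]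
        gcongr _ * ?_
        have h2 : (2 : ℝ≥0∞) ^ j ≠ 0 := by positivity
        have h3 : (2 : ℝ≥0∞) ^ j ≠ ∞ := by finiteness
        rw [← ENNReal.div_eq_inv_mul, ENNReal.le_div_iff_mul_le (Or.inl h2) (Or.inl h3),
          ENNReal.le_div_iff_mul_le (Or.inl ht0) (Or.inl ht)]
        refine le_trans (le_of_eq ?_) (hN (2 ^ j * t))
        ring
    _ = _ := by rw [ENNReal.tsum_mul_right]; rfl

/-- The `A₁` constant of `(M h) ^ δ`, uniform in `h`. -/
noncomputable def coifmanRochbergConst (n : ℕ) (δ : ℝ) : ℝ≥0∞ :=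
  1 + kolmogorovConst δ * 15 ^ n + (3 ^ n) ^ δ

lemma coifmanRochbergConst_lt_top {δ : ℝ} (h0 : 0 < δ) (h1 : δ < 1) :
    coifmanRochbergConst n δ < ∞ := by
  have := kolmogorovConst_lt_top h1
  have h3 : ((3 : ℝ≥0∞) ^ n) ^ δ ≠ ∞ := ENNReal.rpow_ne_top_of_nonneg h0.le (by finiteness)
  unfold coifmanRochbergConst
  finiteness

lemma one_le_coifmanRochbergConst (δ : ℝ) : 1 ≤ coifmanRochbergConst n δ := by
  rw [coifmanRochbergConst, add_assoc]
  exact le_self_add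

/-- Functions supported off the tripled cube have almost constant maximal function on the cube:
a cube which meets both is so large that its triple contains the original cube. -/
lemma maximalFunction_indicator_compl_le (h : (Fin n → ℝ) → ℝ≥0∞) {c x z : Fin n → ℝ} {r : ℝ}
    (hx : x ∈ Metric.closedBall c r) (hz : z ∈ Metric.closedBall c r) :
    maximalFunction ((Metric.closedBall c (3 * r))ᶜ.indicator h) z ≤
      3 ^ n * maximalFunction h x := by
  refine maximalFunction_le_iff.2 fun c' r' hr' hz' => ?_
  rw [Metric.mem_closedBall] at hx hz hz'
  rcases lt_or_ge r' r with hlt | hge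
  · have hsub : Metric.closedBall c' r' ⊆ Metric.closedBall c (3 * r) := by
      intro a ha
      rw [Metric.mem_closedBall] at ha ⊢
      have h1 := dist_triangle a c' z
      have h2 := dist_triangle a z c
      rw [dist_comm c' z] at h1
      linarith
    have h0 : ∫⁻ y in Metric.closedBall c' r', (Metric.closedBall c (3 * r))ᶜ.indicator h y = 0 := by
      rw [setLIntegral_congr_fun Metric.isClosed_closedBall.measurableSet
        (g := fun _ => 0) fun y hy => indicator_of_notMem (by simpa using hsub hy) h]
      simp
    rw [h0]
    exact zero_le
  · have hmem : x ∈ Metric.closedBall c' (3 * r') := by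
      rw [Metric.mem_closedBall]
      have h1 := dist_triangle x c c'
      have h2 := dist_triangle c z c'
      rw [dist_comm c z] at h2
      linarith
    calc ∫⁻ y in Metric.closedBall c' r', (Metric.closedBall c (3 * r))ᶜ.indicator h y
        ≤ ∫⁻ y in Metric.closedBall c' r', h y := lintegral_mono (indicator_le_self _ h)
      _ ≤ ∫⁻ y in Metric.closedBall c' (3 * r'), h y :=
          lintegral_mono_set (Metric.closedBall_subset_closedBall (by linarith))
      _ ≤ maximalFunction h x * volume (Metric.closedBall c' (3 * r')) :=
          setLIntegral_le_maximalFunction_mul h (by positivity) hmem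
      _ = 3 ^ n * maximalFunction h x * volume (Metric.closedBall c' r') := by
          rw [volume_closedBall_smul c' c' (by norm_num) hr'.le, ENNReal.ofReal_ofNat]
          ring

/-- The Coifman–Rochberg theorem: `(M h) ^ δ` is an `A₁` weight. -/
lemma maximalFunction_rpow_maximalFunction_le (hn : 1 ≤ n) {δ : ℝ} (h0 : 0 < δ) (h1 : δ < 1)
    {h : (Fin n → ℝ) → ℝ≥0∞} (hm : Measurable h) (x : Fin n → ℝ) :
    maximalFunction (fun y => maximalFunction h y ^ δ) x ≤
      coifmanRochbergConst n δ * maximalFunction h x ^ δ := by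
  rcases eq_or_ne (maximalFunction h x) ∞ with hM | hM
  · rw [hM, ENNReal.top_rpow_of_pos h0, ENNReal.mul_top]
    · exact le_top
    · exact (one_pos.trans_le (one_le_coifmanRochbergConst δ)).ne'
  -- It suffices to bound the left side by `C t ^ δ` for all finite `t > M h x`; this avoids a
  -- separate treatment of `M h x = 0`.
  suffices H : ∀ t, maximalFunction h x < t → t ≠ ∞ →
      maximalFunction (fun y => maximalFunction h y ^ δ) x ≤ coifmanRochbergConst n δ * t ^ δ by
    have hC := (coifmanRochbergConst_lt_top (n := n) h0 h1).ne
    have hcont : Continuous fun t : ℝ≥0∞ => coifmanRochbergConst n δ * t ^ δ :=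
      (ENNReal.continuous_const_mul hC).comp ENNReal.continuous_rpow_const
    have : Filter.NeBot (𝓝[>] (maximalFunction h x)) := nhdsGT_neBot_of_exists_gt ⟨∞, hM.lt_top⟩
    have hlim : Tendsto (fun t : ℝ≥0∞ => coifmanRochbergConst n δ * t ^ δ)
        (𝓝[>] (maximalFunction h x)) (𝓝 (coifmanRochbergConst n δ * maximalFunction h x ^ δ)) :=
      (hcont.tendsto (maximalFunction h x)).mono_left nhdsWithin_le_nhds
    refine ge_of_tendsto hlim ?_
    filter_upwards [Ioo_mem_nhdsGT hM.lt_top] with t ht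
    exact H t ht.1 ht.2.ne
  intro t ht ht'
  have ht0 : t ≠ 0 := (zero_le.trans_lt ht).ne'
  refine maximalFunction_le_iff.2 fun c r hr hx => ?_
  set Q := Metric.closedBall c r with hQ
  set T := Metric.closedBall c (3 * r) with hT
  have hTm : MeasurableSet T := Metric.isClosed_closedBall.measurableSet
  have hTint : ∫⁻ y, T.indicator h y ≤ 3 ^ n * t * volume Q := by
    rw [lintegral_indicator hTm]
    calc ∫⁻ y in T, h y ≤ maximalFunction h x * volume T :=
          setLIntegral_le_maximalFunction_mul h (by positivity)
            (Metric.closedBall_subset_closedBall (by linarith) hx)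
      _ ≤ t * volume T := by gcongr
      _ = 3 ^ n * t * volume Q := by
          rw [hT, volume_closedBall_smul c c (by norm_num) hr.le, ENNReal.ofReal_ofNat]
          ring
  have hnear : ∫⁻ y in Q, maximalFunction (T.indicator h) y ^ δ ≤
      t ^ δ * (volume Q + kolmogorovConst δ * (15 ^ n * t * volume Q / t)) := by
    have := lintegral_rpow_le_of_weak_type (ν := volume.restrict Q)
      (measurable_maximalFunction (T.indicator h)) (N := 15 ^ n * t * volume Q) (fun y => by
        calc y * distribution (volume.restrict Q) (maximalFunction (T.indicator h)) y
            ≤ y * distribution volume (maximalFunction (T.indicator h)) y := by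
              gcongr
              exact Measure.restrict_apply_le _ _
          _ ≤ 5 ^ n * ∫⁻ y, T.indicator h y := mul_distribution_maximalFunction_le hn _ y
          _ ≤ 5 ^ n * (3 ^ n * t * volume Q) := by gcongr
          _ = 15 ^ n * t * volume Q := by
              rw [show (15 : ℝ≥0∞) = 5 * 3 by norm_num, mul_pow]; ring) h0 ht0 ht'
    rwa [Measure.restrict_apply_univ] at this
  have hfar : ∀ y ∈ Q, maximalFunction (Tᶜ.indicator h) y ^ δ ≤ (3 ^ n) ^ δ * t ^ δ := by
    intro y hy
    rw [← ENNReal.mul_rpow_of_nonneg _ _ h0.le]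
    gcongr
    exact (maximalFunction_indicator_compl_le h hx hy).trans (by gcongr)
  have hsplit : ∀ y, maximalFunction h y ^ δ ≤
      maximalFunction (T.indicator h) y ^ δ + maximalFunction (Tᶜ.indicator h) y ^ δ := by
    intro y
    refine le_trans ?_ (ENNReal.rpow_add_le_add_rpow _ _ h0.le h1.le)
    gcongr
    have := maximalFunction_add_le (k := Tᶜ.indicator h) (hm.indicator hTm) y
    rwa [show (fun z => T.indicator h z + Tᶜ.indicator h z) = h from
      indicator_self_add_compl T h] at this
  calc ∫⁻ y in Q, maximalFunction h y ^ δ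
      ≤ ∫⁻ y in Q, (maximalFunction (T.indicator h) y ^ δ + (3 ^ n) ^ δ * t ^ δ) :=
        setLIntegral_mono' Metric.isClosed_closedBall.measurableSet fun y hy =>
          (hsplit y).trans (by gcongr; exact hfar y hy)
    _ = (∫⁻ y in Q, maximalFunction (T.indicator h) y ^ δ) + (3 ^ n) ^ δ * t ^ δ * volume Q := by
        rw [lintegral_add_right _ measurable_const, setLIntegral_const]
    _ ≤ t ^ δ * (volume Q + kolmogorovConst δ * (15 ^ n * t * volume Q / t)) +
          (3 ^ n) ^ δ * t ^ δ * volume Q := by gcongr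
    _ = coifmanRochbergConst n δ * t ^ δ * volume Q := by
        rw [show 15 ^ n * t * volume Q = 15 ^ n * volume Q * t by ring,
          ENNReal.mul_div_cancel_right ht0 ht', coifmanRochbergConst]
        ring

/-! ### Construction of `A_p` weights -/

lemma rpow_le_rpow_of_exponent_nonpos {x y : ℝ≥0∞} {z : ℝ} (hz : z ≤ 0) (hxy : x ≤ y) :
    y ^ z ≤ x ^ z := by
  rw [← neg_neg z, ENNReal.rpow_neg y, ENNReal.rpow_neg x, ENNReal.inv_le_inv]
  exact ENNReal.rpow_le_rpow hxy (by linarith)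

/-- The easy half of the factorization theorem: `u ^ (1 - p) v` is an `A_p` weight if `u` and `v`
are `A₁` weights. Here `u` and `v` satisfy the `A₁` condition at every point, as powers of maximal
functions do. -/
lemma isMuckenhoupt_rpow_mul {p : ℝ} (hp : 1 ≤ p) {C : ℝ≥0∞} (hC0 : C ≠ 0) (hC : C ≠ ∞)
    {u v : (Fin n → ℝ) → ℝ≥0∞} (hum : Measurable u) (hvm : Measurable v)
    (hu0 : ∀ x, 0 < u x) (hu : ∀ᵐ x, u x < ∞) (hv0 : ∀ x, 0 < v x) (hv : ∀ x, v x ≤ 1)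
    (hMu : ∀ x, maximalFunction u x ≤ C * u x) (hMv : ∀ x, maximalFunction v x ≤ C * v x) :
    IsMuckenhoupt p (fun x => u x ^ (1 - p) * v x) ∧
      muckenhouptConst p (fun x => u x ^ (1 - p) * v x) ≤ C ^ p := by
  have hvt : ∀ x, v x ≠ ∞ := fun x => ((hv x).trans_lt ENNReal.one_lt_top).ne
  have hQm : ∀ (c : Fin n → ℝ) (r : ℝ), MeasurableSet (Metric.closedBall c r) := fun c r =>
    Metric.isClosed_closedBall.measurableSet
  have avg_pos : ∀ k : (Fin n → ℝ) → ℝ≥0∞, Measurable k → (∀ x, 0 < k x) →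
      ∀ (c : Fin n → ℝ) (r : ℝ), 0 < r → ⨍⁻ x in Metric.closedBall c r, k x ∂volume ≠ 0 := by
    intro k hk hk0 c r hr
    rw [setLAverage_eq]
    refine (ENNReal.div_pos ?_ measure_closedBall_lt_top.ne).ne'
    rw [← pos_iff_ne_zero, setLIntegral_pos_iff hk, Function.support_eq_univ fun x => (hk0 x).ne',
      univ_inter]
    exact Metric.measure_closedBall_pos volume c hr
  have avg_u : ∀ (c : Fin n → ℝ) (r : ℝ), 0 < r →
      ⨍⁻ x in Metric.closedBall c r, u x ∂volume ≠ ∞ := by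
    intro c r hr
    have hne : (Metric.closedBall c r ∩ {x | u x < ∞}).Nonempty := by
      refine nonempty_of_measure_ne_zero (μ := volume) ?_
      rw [measure_inter_conull hu]
      exact (Metric.measure_closedBall_pos volume c hr).ne'
    obtain ⟨x, hx, hxu⟩ := hne
    exact ((setLAverage_le_maximalFunction u hr hx).trans_lt
      ((hMu x).trans_lt (ENNReal.mul_lt_top hC.lt_top hxu))).ne
  have lower : ∀ k : (Fin n → ℝ) → ℝ≥0∞, (∀ x, maximalFunction k x ≤ C * k x) →
      ∀ (c : Fin n → ℝ) (r : ℝ), 0 < r → ∀ x ∈ Metric.closedBall c r,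
        (⨍⁻ x in Metric.closedBall c r, k x ∂volume) / C ≤ k x := by
    intro k hk c r hr x hx
    rw [ENNReal.div_le_iff hC0 hC, mul_comm]
    exact (setLAverage_le_maximalFunction k hr hx).trans (hk x)
  have upper : ∀ (c : Fin n → ℝ) (r : ℝ), 0 < r → ∀ x ∈ Metric.closedBall c r,
      u x ^ (1 - p) * v x ≤
        ((⨍⁻ x in Metric.closedBall c r, u x ∂volume) / C) ^ (1 - p) * v x := by
    intro c r hr x hx
    gcongr ?_ * _
    exact rpow_le_rpow_of_exponent_nonpos (by linarith) (lower u hMu c r hr x hx)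
  have hfac : ∀ (c : Fin n → ℝ) (r : ℝ), 0 < r →
      ((⨍⁻ x in Metric.closedBall c r, u x ∂volume) / C) ^ (1 - p) ≠ ∞ := by
    intro c r hr
    exact ENNReal.rpow_ne_top_of_nonneg'
      (ENNReal.div_pos (avg_pos u hum hu0 c r hr) hC)
      (ENNReal.div_ne_top (avg_u c r hr) hC0)
  have hconst : muckenhouptConst p (fun x => u x ^ (1 - p) * v x) ≤ C ^ p := by
    rcases eq_or_ne p 1 with rfl | hp1
    · simp only [muckenhouptConst, if_true, sub_self, ENNReal.rpow_zero, one_mul, ENNReal.rpow_one]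
      refine sInf_le ?_
      exact ae_of_all volume hMv
    have hp' : 0 < p - 1 := by
      have := lt_of_le_of_ne hp hp1.symm
      linarith
    rw [muckenhouptConst, if_neg hp1]
    refine iSup_le fun c => iSup_le fun r => iSup_le fun hr => ?_
    set a := ⨍⁻ x in Metric.closedBall c r, u x ∂volume with ha
    set b := ⨍⁻ x in Metric.closedBall c r, v x ∂volume with hb
    have ha0 : a ≠ 0 := avg_pos u hum hu0 c r hr
    have hat : a ≠ ∞ := avg_u c r hr
    have hb0 : b ≠ 0 := avg_pos v hvm hv0 c r hr
    have hbt : b ≠ ∞ := by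
      have := setLAverage_le_maximalFunction v hr (Metric.mem_closedBall_self (x := c) hr.le)
      exact (this.trans_lt ((hMv c).trans_lt (ENNReal.mul_lt_top hC.lt_top (hvt c).lt_top))).ne
    have h1 : ⨍⁻ x in Metric.closedBall c r, u x ^ (1 - p) * v x ∂volume ≤
        (a / C) ^ (1 - p) * b := by
      rw [hb, setLAverage_eq, setLAverage_eq, ← mul_div_assoc,
        ← lintegral_const_mul' _ _ (hfac c r hr)]
      gcongr ?_ / _
      exact setLIntegral_mono' (hQm c r) (upper c r hr)
    have h2 : ⨍⁻ x in Metric.closedBall c r, (u x ^ (1 - p) * v x) ^ (-(1 / (p - 1))) ∂volume ≤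
        (b / C) ^ (-(1 / (p - 1))) * a := by
      have hne : (b / C) ^ (-(1 / (p - 1))) ≠ ∞ :=
        ENNReal.rpow_ne_top_of_nonneg' (ENNReal.div_pos hb0 hC) (ENNReal.div_ne_top hbt hC0)
      rw [ha, setLAverage_eq, setLAverage_eq, ← mul_div_assoc, ← lintegral_const_mul' _ _ hne]
      gcongr ?_ / _
      refine setLIntegral_mono_ae' (hQm c r) ?_
      filter_upwards [hu] with x hux hx
      have hx1 : u x ^ (1 - p) ≠ ∞ := ENNReal.rpow_ne_top_of_nonneg' (hu0 x) hux.ne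
      rw [ENNReal.mul_rpow_of_ne_top hx1 (hvt x), ← ENNReal.rpow_mul,
        show (1 - p) * -(1 / (p - 1)) = 1 by field_simp; ring, ENNReal.rpow_one, mul_comm]
      gcongr ?_ * _
      refine rpow_le_rpow_of_exponent_nonpos ?_ (lower v hMv c r hr x hx)
      rw [neg_nonpos]
      positivity
    calc _ ≤ ((a / C) ^ (1 - p) * b) * ((b / C) ^ (-(1 / (p - 1))) * a) ^ (p - 1) := by gcongr
      _ = C ^ p := by
        rw [ENNReal.mul_rpow_of_nonneg _ _ hp'.le, ← ENNReal.rpow_mul,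
          show -(1 / (p - 1)) * (p - 1) = -1 by field_simp, ENNReal.rpow_neg_one,
          show 1 - p = -(p - 1) by ring, ENNReal.rpow_neg, ← ENNReal.inv_rpow,
          ENNReal.inv_div (Or.inl hC) (Or.inl hC0), ENNReal.inv_div (Or.inl hC) (Or.inl hC0),
          show (C / a) ^ (p - 1) * b * (C / b * a ^ (p - 1)) =
            ((C / a) ^ (p - 1) * a ^ (p - 1)) * (C / b * b) by ring,
          ← ENNReal.mul_rpow_of_nonneg _ _ hp'.le, ENNReal.div_mul_cancel ha0 hat,
          ENNReal.div_mul_cancel hb0 hbt]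
        nth_rewrite 2 [← ENNReal.rpow_one C]
        rw [← ENNReal.rpow_add _ _ hC0 hC, sub_add_cancel]
  refine ⟨⟨(hum.pow_const _).mul hvm, ?_, ?_, ?_, ?_⟩, hconst⟩
  · filter_upwards [hu] with x hx
    exact ENNReal.mul_pos (ENNReal.rpow_pos (hu0 x) hx.ne).ne' (hv0 x).ne' |>.bot_lt
  · filter_upwards [hu] with x hx
    exact ENNReal.mul_lt_top (ENNReal.rpow_ne_top_of_nonneg' (hu0 x) hx.ne).lt_top (hvt x).lt_top
  · intro c r
    -- The radius may be nonpositive here, while the bounds above are for genuine cubes.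
    refine (lintegral_mono_set (Metric.closedBall_subset_closedBall
      (le_max_left r 1))).trans_lt ?_
    have hr : 0 < max r 1 := by positivity
    refine (setLIntegral_mono' (hQm c _) (upper c _ hr)).trans_lt ?_
    rw [lintegral_const_mul' _ _ (hfac c _ hr)]
    refine ENNReal.mul_lt_top (hfac c _ hr).lt_top ?_
    refine (setLIntegral_mono measurable_const fun x _ => hv x).trans_lt ?_
    rw [setLIntegral_const, one_mul]
    exact measure_closedBall_lt_top
  · exact hconst.trans_lt (ENNReal.rpow_lt_top_of_nonneg (by linarith) hC)

/-! ### Rearrangements and the Hardy–Littlewood inequality -/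

/-- The volume of the cube centred at `0` with `x` on its boundary. It transports decreasing
functions on `(0, ∞)` to radial functions on `ℝⁿ`. -/
noncomputable def cubeVolume (x : Fin n → ℝ) : ℝ := (2 * ‖x‖) ^ n

lemma cubeVolume_nonneg (x : Fin n → ℝ) : 0 ≤ cubeVolume x := by
  unfold cubeVolume; positivity

lemma measurable_cubeVolume : Measurable (cubeVolume (n := n)) := by
  unfold cubeVolume; fun_prop

lemma volume_cubeVolume_le (hn : 1 ≤ n) (b : ℝ) :
    volume {x : Fin n → ℝ | cubeVolume x ≤ b} = ENNReal.ofReal b := by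
  have hn0 : n ≠ 0 := by omega
  rcases lt_or_ge b 0 with hb | hb
  · rw [ENNReal.ofReal_of_nonpos hb.le]
    convert measure_empty (μ := volume)
    ext x
    simp only [mem_ofPred_eq, mem_empty_iff_false, iff_false, not_le]
    exact hb.trans_le (cubeVolume_nonneg x)
  · have hroot : (b ^ (n⁻¹ : ℝ)) ^ n = b := Real.rpow_inv_natCast_pow hb hn0
    have hpos : 0 ≤ b ^ (n⁻¹ : ℝ) := Real.rpow_nonneg hb _
    have : {x : Fin n → ℝ | cubeVolume x ≤ b} = Metric.closedBall 0 (b ^ (n⁻¹ : ℝ) / 2) := by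
      ext x
      rw [mem_ofPred_eq, mem_closedBall_zero_iff, cubeVolume]
      nth_rewrite 1 [← hroot]
      rw [pow_le_pow_iff_left₀ (by positivity) hpos hn0, le_div_iff₀ (by norm_num), mul_comm]
    rw [this, Real.volume_pi_closedBall _ (by positivity), Fintype.card_fin,
      mul_div_cancel₀ _ (by norm_num), hroot]

lemma measurePreserving_cubeVolume (hn : 1 ≤ n) :
    MeasurePreserving (cubeVolume (n := n)) volume (volume.restrict (Ioi 0)) := by
  refine ⟨measurable_cubeVolume, Eq.symm ?_⟩
  refine Measure.ext_of_Ioc _ _ fun a b hab => ?_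
  rw [Measure.map_apply measurable_cubeVolume measurableSet_Ioc,
    Measure.restrict_apply measurableSet_Ioc]
  have h1 : cubeVolume (n := n) ⁻¹' Ioc a b = {x | cubeVolume x ≤ b} \ {x | cubeVolume x ≤ a} := by
    ext x
    simp [and_comm]
  have h2 : Ioc a b ∩ Ioi 0 = Ioc (max a 0) b := by
    ext t
    simp only [mem_inter_iff, mem_Ioc, mem_Ioi, max_lt_iff]
    tauto
  have hsub : {x : Fin n → ℝ | cubeVolume x ≤ a} ⊆ {x | cubeVolume x ≤ b} :=
    fun x hx => le_trans hx hab.le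
  have hms : MeasurableSet {x : Fin n → ℝ | cubeVolume x ≤ a} :=
    measurable_cubeVolume measurableSet_Iic
  rw [h1, measure_sdiff hsub hms.nullMeasurableSet
    (by rw [volume_cubeVolume_le hn]; exact ENNReal.ofReal_ne_top), volume_cubeVolume_le hn,
    volume_cubeVolume_le hn, h2, Real.volume_Ioc]
  rcases le_total a 0 with ha | ha
  · rw [max_eq_right ha, ENNReal.ofReal_of_nonpos ha, sub_zero, tsub_zero]
  · rw [max_eq_left ha, ENNReal.ofReal_sub _ ha]

lemma volume_Ioi_ofReal_lt (a : ℝ≥0∞) :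
    volume.restrict (Ioi (0 : ℝ)) {t | ENNReal.ofReal t < a} = a := by
  rw [Measure.restrict_apply (measurableSet_lt ENNReal.measurable_ofReal measurable_const)]
  rcases eq_or_ne a ∞ with rfl | ha
  · simp
  · have : {t | ENNReal.ofReal t < a} ∩ Ioi 0 = Ioo 0 a.toReal := by
      ext t
      simp only [mem_inter_iff, mem_ofPred_eq, mem_Ioi, mem_Ioo, and_comm (a := 0 < t)]
      refine and_congr_left fun ht => ?_
      rw [ENNReal.ofReal_lt_iff_lt_toReal ht.le ha]
    rw [this, Real.volume_Ioo, sub_zero, ENNReal.ofReal_toReal ha]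

lemma volume_cubeVolume_lt (hn : 1 ≤ n) (a : ℝ≥0∞) :
    volume {x : Fin n → ℝ | ENNReal.ofReal (cubeVolume x) < a} = a := by
  have := (measurePreserving_cubeVolume hn).measure_preimage (s := {t | ENNReal.ofReal t < a})
    (measurableSet_lt ENNReal.measurable_ofReal measurable_const).nullMeasurableSet
  rw [volume_Ioi_ofReal_lt] at this
  exact this

/-- Right continuity of the distribution function makes the infimum in the definition of `f^*`
a minimum. -/
lemma distribution_le_of_decreasingRearrangement_le {α : Type*} [MeasurableSpace α]
    {ν : Measure α} {f : α → ℝ≥0∞} {t y : ℝ≥0∞} (h : decreasingRearrangement ν f t ≤ y) :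
    distribution ν f y ≤ t := by
  have hne : {y | distribution ν f y ≤ t}.Nonempty := ⟨∞, by simp [distribution]⟩
  obtain ⟨u, hu, hlim, hmem⟩ := exists_seq_tendsto_sInf hne (OrderBot.bddBelow _)
  have hsub : {x | y < f x} ⊆ ⋃ k, {x | u k < f x} := by
    intro x hx
    obtain ⟨k, hk⟩ := (hlim.eventually_lt_const (h.trans_lt hx)).exists
    exact mem_iUnion.2 ⟨k, hk⟩
  refine (measure_mono hsub).trans ?_
  have hmono : Monotone fun k => {x | u k < f x} := fun i j hij x hx => (hu hij).trans_lt hx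
  rw [hmono.measure_iUnion]
  exact iSup_le hmem

lemma lt_decreasingRearrangement_iff {α : Type*} [MeasurableSpace α] {ν : Measure α}
    {f : α → ℝ≥0∞} {t y : ℝ≥0∞} : y < decreasingRearrangement ν f t ↔ t < distribution ν f y := by
  rw [← not_le, ← not_le, not_iff_not]
  exact ⟨distribution_le_of_decreasingRearrangement_le, fun h => sInf_le h⟩

lemma decreasingRearrangement_antitone {α : Type*} [MeasurableSpace α] (ν : Measure α)
    (f : α → ℝ≥0∞) : Antitone (decreasingRearrangement ν f) := fun _ _ hst =>
  sInf_le_sInf fun _ hy => le_trans hy hst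

/-- The radially decreasing function on `ℝⁿ` which is equimeasurable with `f`. -/
noncomputable def symmetricRearrangement (f : (Fin n → ℝ) → ℝ≥0∞) (x : Fin n → ℝ) : ℝ≥0∞ :=
  decreasingRearrangement volume f (ENNReal.ofReal (cubeVolume x))

lemma measurable_symmetricRearrangement (f : (Fin n → ℝ) → ℝ≥0∞) :
    Measurable (symmetricRearrangement f) :=
  (decreasingRearrangement_antitone volume f).measurable.comp
    (ENNReal.measurable_ofReal.comp measurable_cubeVolume)

lemma distribution_symmetricRearrangement (hn : 1 ≤ n) (f : (Fin n → ℝ) → ℝ≥0∞) (y : ℝ≥0∞) :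
    distribution volume (symmetricRearrangement f) y = distribution volume f y := by
  simp only [distribution, symmetricRearrangement, lt_decreasingRearrangement_iff]
  exact volume_cubeVolume_lt hn _

lemma lintegral_eq_lintegral_distribution {α : Type*} [MeasurableSpace α] {ν : Measure α}
    [SFinite ν] {f : α → ℝ≥0∞} (hf : Measurable f) :
    ∫⁻ x, f x ∂ν = ∫⁻ a in Ioi (0 : ℝ), distribution ν f (ENNReal.ofReal a) := by
  have hms : MeasurableSet {p : α × ℝ | ENNReal.ofReal p.2 < f p.1} :=
    measurableSet_lt (ENNReal.measurable_ofReal.comp measurable_snd) (hf.comp measurable_fst)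
  set S := {p : α × ℝ | ENNReal.ofReal p.2 < f p.1}
  calc ∫⁻ x, f x ∂ν
      = ∫⁻ x, (∫⁻ a in Ioi (0 : ℝ), S.indicator 1 (x, a)) ∂ν := by
        refine lintegral_congr fun x => ?_
        have := lintegral_indicator_one (μ := volume.restrict (Ioi (0 : ℝ)))
          (measurableSet_lt ENNReal.measurable_ofReal (measurable_const (a := f x)))
        rw [volume_Ioi_ofReal_lt] at this
        exact this.symm
    _ = ∫⁻ a in Ioi (0 : ℝ), (∫⁻ x, S.indicator 1 (x, a) ∂ν) :=
        lintegral_lintegral_swap (f := fun x a => S.indicator 1 (x, a))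
          (measurable_one.indicator hms).aemeasurable
    _ = _ := by
        refine lintegral_congr fun a => ?_
        exact lintegral_indicator_one (μ := ν) (measurableSet_lt
          (measurable_const (a := ENNReal.ofReal a)) hf)

lemma lintegral_mul_eq_lintegral_measure_inter {f g : (Fin n → ℝ) → ℝ≥0∞}
    (hf : Measurable f) (hg : Measurable g) :
    ∫⁻ x, f x * g x = ∫⁻ a in Ioi (0 : ℝ), ∫⁻ b in Ioi (0 : ℝ),
      volume ({x | ENNReal.ofReal b < g x} ∩ {x | ENNReal.ofReal a < f x}) := by
  have h1 : ∫⁻ x, f x * g x = ∫⁻ x, f x ∂(volume.withDensity g) := by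
    rw [lintegral_withDensity_eq_lintegral_mul _ hg hf]
    exact lintegral_congr fun x => mul_comm _ _
  rw [h1, lintegral_eq_lintegral_distribution hf]
  refine lintegral_congr fun a => ?_
  have hm : MeasurableSet {x | ENNReal.ofReal a < f x} := measurableSet_lt measurable_const hf
  rw [distribution, withDensity_apply _ hm, lintegral_eq_lintegral_distribution hg]
  refine lintegral_congr fun b => ?_
  exact Measure.restrict_apply (measurableSet_lt measurable_const hg)

/-- The Hardy–Littlewood rearrangement inequality, in a form which allows for a comparison of the
distribution functions: `∫ f g` increases when the distribution functions increase and the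
superlevel sets become nested. -/
lemma lintegral_mul_le_of_distribution_le {f g f' g' : (Fin n → ℝ) → ℝ≥0∞}
    (hf : Measurable f) (hg : Measurable g) (hf' : Measurable f') (hg' : Measurable g')
    (hff : ∀ y, distribution volume f y ≤ distribution volume f' y)
    (hgg : ∀ y, distribution volume g y ≤ distribution volume g' y)
    (hnest : ∀ a b, {x | a < f' x} ⊆ {x | b < g' x} ∨ {x | b < g' x} ⊆ {x | a < f' x}) :
    ∫⁻ x, f x * g x ≤ ∫⁻ x, f' x * g' x := by
  rw [lintegral_mul_eq_lintegral_measure_inter hf hg,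
    lintegral_mul_eq_lintegral_measure_inter hf' hg']
  refine lintegral_mono fun a => lintegral_mono fun b => ?_
  rcases hnest (ENNReal.ofReal a) (ENNReal.ofReal b) with h | h
  · rw [inter_eq_self_of_subset_right h]
    exact (measure_mono inter_subset_right).trans (hff _)
  · rw [inter_eq_self_of_subset_left h]
    exact (measure_mono inter_subset_left).trans (hgg _)

/-! ### Duality -/

lemma lintegral_mul_le_associateNorm (X : QuasiBanachRISpace n) {f g : (Fin n → ℝ) → ℝ≥0∞}
    (hg : Measurable g) (h0 : X.norm g ≠ 0) (ht : X.norm g ≠ ∞) :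
    ∫⁻ x, f x * g x ≤ associateNorm X.norm f * X.norm g := by
  have hinv : ((X.norm g).toNNReal⁻¹ : ℝ≥0) = (X.norm g)⁻¹ := by
    rw [ENNReal.coe_inv (by simp [ENNReal.toNNReal_eq_zero_iff, h0, ht]), ENNReal.coe_toNNReal ht]
  have h1 : X.norm (fun x => ((X.norm g).toNNReal⁻¹ : ℝ≥0) * g x) ≤ 1 := by
    rw [X.norm_const_mul _ _ hg, hinv, ENNReal.inv_mul_cancel h0 ht]
  have h2 : ∫⁻ x, f x * (((X.norm g).toNNReal⁻¹ : ℝ≥0) * g x) ≤ associateNorm X.norm f :=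
    le_iSup₂_of_le (f := fun (g : (Fin n → ℝ) → ℝ≥0∞) (_ : Measurable g) =>
      ⨆ (_ : X.norm g ≤ 1), ∫⁻ x, f x * g x) _ (hg.const_mul _) (le_iSup_of_le h1 le_rfl)
  have h3 : ∫⁻ x, f x * (((X.norm g).toNNReal⁻¹ : ℝ≥0) * g x) =
      (X.norm g)⁻¹ * ∫⁻ x, f x * g x := by
    rw [← lintegral_const_mul' _ _ (ENNReal.inv_ne_top.2 h0), hinv]
    exact lintegral_congr fun x => by ring
  rw [h3, ← ENNReal.div_eq_inv_mul, ENNReal.div_le_iff h0 ht] at h2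
  exact h2

/-- Hölder's inequality for `X` and `X'`, when the second function is dominated by a multiple of a
decreasing function `h` on `(0, ∞)` in the sense of distribution functions. -/
lemma lintegral_mul_le_representationNorm (hn : 1 ≤ n) (X : QuasiBanachRISpace n)
    {f F : (Fin n → ℝ) → ℝ≥0∞} (hf : Measurable f) (hF : Measurable F)
    (h0 : X.norm f ≠ 0) (ht : X.norm f ≠ ∞) {h : ℝ → ℝ≥0∞} (hh : Measurable h)
    (hanti : AntitoneOn h (Ici 0)) {c : ℝ≥0∞}
    (hdom : ∀ y, distribution volume F y ≤
      distribution (volume.restrict (Ioi (0 : ℝ))) (fun t => c * h t) y) :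
    ∫⁻ x, f x * F x ≤ c * representationNorm (n := n) (associateNorm X.norm) h * X.norm f := by
  set G : (Fin n → ℝ) → ℝ≥0∞ := fun x => h (cubeVolume x) with hG
  have hGm : Measurable G := hh.comp measurable_cubeVolume
  have hdist : ∀ k : ℝ → ℝ≥0∞, Measurable k → ∀ y,
      distribution volume (fun x : Fin n → ℝ => k (cubeVolume x)) y =
        distribution (volume.restrict (Ioi (0 : ℝ))) k y := fun k hk y =>
    (measurePreserving_cubeVolume hn).measure_preimage
      (measurableSet_lt measurable_const hk).nullMeasurableSet
  have hfs := measurable_symmetricRearrangement f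
  have hnorm : X.norm (symmetricRearrangement f) = X.norm f :=
    X.rearrangement_invariant _ _ hfs hf (distribution_symmetricRearrangement hn f)
  have hHL : ∫⁻ x, f x * F x ≤ ∫⁻ x, symmetricRearrangement f x * (c * G x) := by
    refine lintegral_mul_le_of_distribution_le hf hF hfs (hGm.const_mul c)
      (fun y => (distribution_symmetricRearrangement hn f y).ge)
      (fun y => (hdom y).trans (hdist _ (hh.const_mul c) y).ge) fun a b => ?_
    by_contra! H
    obtain ⟨⟨x, hx, hx'⟩, ⟨z, hz, hz'⟩⟩ := And.imp not_subset.1 not_subset.1 H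
    simp only [mem_ofPred_eq, not_lt] at hx hx' hz hz'
    rcases le_total (cubeVolume x) (cubeVolume z) with hxz | hxz
    · have : G z ≤ G x := hanti (cubeVolume_nonneg x) (cubeVolume_nonneg z) hxz
      exact absurd (hz.trans_le (mul_le_mul_right this c)) (not_lt.2 hx')
    · have : symmetricRearrangement f x ≤ symmetricRearrangement f z :=
        decreasingRearrangement_antitone _ _ (ENNReal.ofReal_le_ofReal hxz)
      exact absurd (hx.trans_le this) (not_lt.2 hz')
  calc ∫⁻ x, f x * F x ≤ ∫⁻ x, symmetricRearrangement f x * (c * G x) := hHL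
    _ = c * ∫⁻ x, G x * symmetricRearrangement f x := by
        rw [← lintegral_const_mul c (f := fun x => G x * symmetricRearrangement f x) (hGm.mul hfs)]
        exact lintegral_congr fun x => by ring
    _ ≤ c * (associateNorm X.norm G * X.norm (symmetricRearrangement f)) := by
        gcongr
        exact lintegral_mul_le_associateNorm X hfs (by rwa [hnorm]) (by rwa [hnorm])
    _ ≤ c * (representationNorm (associateNorm X.norm) h * X.norm f) := by
        rw [hnorm]
        gcongr
        exact le_iSup₂_of_le (f := fun (f : (Fin n → ℝ) → ℝ≥0∞) (_ : Measurable f) =>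
          ⨆ (_ : ∀ y, distribution volume f y = distribution (volume.restrict (Ioi (0 : ℝ))) h y),
            associateNorm X.norm f) G hGm (le_iSup_of_le (hdist h hh) le_rfl)
    _ = _ := by rw [mul_assoc]

/-! ### Maximal functions of indicators and the fundamental function -/

lemma maximalFunction_le_one {h : (Fin n → ℝ) → ℝ≥0∞} (hh : ∀ x, h x ≤ 1) (x : Fin n → ℝ) :
    maximalFunction h x ≤ 1 := by
  refine maximalFunction_le_iff.2 fun c r _ _ => ?_
  refine (setLIntegral_mono measurable_const fun y _ => hh y).trans ?_
  rw [setLIntegral_const]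

lemma indicator_one_le_one {α : Type*} (E : Set α) (x : α) : E.indicator (1 : α → ℝ≥0∞) x ≤ 1 :=
  indicator_le_self' (fun _ _ => zero_le) x

/-- Up to a constant, the decreasing rearrangement of `(M χ_E) ^ μ` at `t` is at most
`(1 + t / |E|) ^ (-μ)`. -/
lemma distribution_maximalFunction_indicator_rpow_le (hn : 1 ≤ n) {E : Set (Fin n → ℝ)}
    (hE : MeasurableSet E) {s : ℝ≥0} (hs : 0 < s) (hEs : volume E = s) {μ : ℝ} (hμ : 0 < μ)
    (y : ℝ≥0∞) :
    distribution volume (fun x => maximalFunction (E.indicator 1) x ^ μ) y ≤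
      distribution (volume.restrict (Ioi (0 : ℝ)))
        (fun t : ℝ => (5 ^ n + 1) ^ μ * ENNReal.ofReal (1 / (1 + t / s) ^ μ)) y := by
  have hs' : (0 : ℝ) < s := hs
  rcases le_or_gt 1 y with hy | hy
  · have : {x | y < maximalFunction (E.indicator 1) x ^ μ} = ∅ := by
      refine eq_empty_of_forall_notMem fun x hx => absurd (hy.trans_lt hx) (not_lt.2 ?_)
      exact ENNReal.rpow_le_one (maximalFunction_le_one (indicator_one_le_one E) x) hμ.le
    rw [distribution, this, measure_empty]
    exact zero_le
  have hconst : ((5 : ℝ≥0∞) ^ n + 1) ^ μ = ENNReal.ofReal ((5 ^ n + 1) ^ μ) := by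
    rw [← ENNReal.ofReal_rpow_of_pos (by positivity), ENNReal.ofReal_add (by positivity) one_pos.le,
      ENNReal.ofReal_pow (by norm_num), ENNReal.ofReal_ofNat, ENNReal.ofReal_one]
  have hh : ∀ t : ℝ, 0 < t → ((5 : ℝ≥0∞) ^ n + 1) ^ μ * ENNReal.ofReal (1 / (1 + t / s) ^ μ) =
      ENNReal.ofReal (((5 ^ n + 1) / (1 + t / s)) ^ μ) := by
    intro t ht
    rw [hconst, ← ENNReal.ofReal_mul (by positivity), Real.div_rpow (by positivity) (by positivity),
      mul_one_div]
  rcases eq_or_ne y 0 with rfl | hy0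
  · refine le_trans le_top (top_le_iff.2 ?_)
    refine top_unique ?_
    rw [← Real.volume_Ioi (a := 0), ← Measure.restrict_apply_self volume (Ioi (0 : ℝ))]
    refine measure_mono fun t (ht : 0 < t) => ?_
    change 0 < ((5 : ℝ≥0∞) ^ n + 1) ^ μ * ENNReal.ofReal (1 / (1 + t / s) ^ μ)
    rw [hh t ht, ENNReal.ofReal_pos]
    positivity
  obtain ⟨b, hb, rfl⟩ : ∃ b : ℝ, 0 < b ∧ y = ENNReal.ofReal b :=
    ⟨y.toReal, ENNReal.toReal_pos hy0 hy.ne_top, (ENNReal.ofReal_toReal hy.ne_top).symm⟩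
  have hb1 : b < 1 := by simpa using hy
  set β : ℝ := b ^ μ⁻¹ with hβ
  have hβ0 : 0 < β := Real.rpow_pos_of_pos hb _
  have hβ1 : β ≤ 1 := Real.rpow_le_one hb.le hb1.le (by positivity)
  have hβμ : β ^ μ = b := Real.rpow_inv_rpow hb.le hμ.ne'
  calc distribution volume (fun x => maximalFunction (E.indicator 1) x ^ μ) (ENNReal.ofReal b)
      = distribution volume (maximalFunction (E.indicator 1)) (ENNReal.ofReal β) := by
        rw [distribution, distribution]
        congr 1
        ext x
        change ENNReal.ofReal b < maximalFunction (E.indicator 1) x ^ μ ↔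
          ENNReal.ofReal β < maximalFunction (E.indicator 1) x
        rw [← hβμ, ← ENNReal.ofReal_rpow_of_pos hβ0, ENNReal.rpow_lt_rpow_iff hμ]
    _ ≤ ENNReal.ofReal (5 ^ n * s / β) := by
        have := mul_distribution_maximalFunction_le hn (E.indicator 1) (ENNReal.ofReal β)
        rw [lintegral_indicator_one hE, hEs] at this
        rw [ENNReal.ofReal_div_of_pos hβ0, ENNReal.le_div_iff_mul_le
          (Or.inl (ENNReal.ofReal_pos.2 hβ0).ne') (Or.inl ENNReal.ofReal_ne_top), mul_comm,
          ENNReal.ofReal_mul (by positivity), ENNReal.ofReal_pow (by norm_num),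
          ENNReal.ofReal_ofNat, ENNReal.ofReal_coe_nnreal]
        exact this
    _ ≤ ENNReal.ofReal ((5 ^ n + 1) * s / β - s) := by
        refine ENNReal.ofReal_le_ofReal ?_
        have : (s : ℝ) ≤ s / β := by rw [le_div_iff₀ hβ0]; nlinarith
        rw [add_mul, add_div, one_mul]
        linarith
    _ = volume.restrict (Ioi 0) (Ioo 0 ((5 ^ n + 1) * s / β - s)) := by
        rw [Measure.restrict_apply measurableSet_Ioo, inter_eq_self_of_subset_left
          (fun t ht => ht.1), Real.volume_Ioo, sub_zero]
    _ ≤ _ := by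
        refine measure_mono fun t ht => ?_
        change ENNReal.ofReal b < ((5 : ℝ≥0∞) ^ n + 1) ^ μ * ENNReal.ofReal (1 / (1 + t / s) ^ μ)
        have ht0 : 0 < t := ht.1
        rw [hh t ht0, ENNReal.ofReal_lt_ofReal_iff (by positivity), ← hβμ]
        refine Real.rpow_lt_rpow hβ0.le ?_ hμ
        have h2 : (t + s) * β < (5 ^ n + 1) * s := by
          rw [← lt_div_iff₀ hβ0]; linarith [ht.2]
        rw [lt_div_iff₀ (by positivity), show β * (1 + t / s) = (t + s) * β / s by field_simp; ring,
          div_lt_iff₀ hs']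
        exact h2

lemma fundamentalFunction_volume (X : QuasiBanachRISpace n) {E : Set (Fin n → ℝ)}
    (hE : MeasurableSet E) :
    fundamentalFunction X.norm (volume E) = X.norm (E.indicator 1) := by
  refine le_antisymm ?_ (le_iSup₂_of_le (f := fun (A : Set (Fin n → ℝ)) (_ : MeasurableSet A) =>
    ⨆ (_ : volume A = volume E), X.norm (A.indicator 1)) E hE (le_iSup_of_le rfl le_rfl))
  refine iSup_le fun A => iSup_le fun hA => iSup_le fun hAE => le_of_eq ?_
  refine X.rearrangement_invariant _ _ (measurable_one.indicator hA) (measurable_one.indicator hE)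
    fun y => ?_
  have key : ∀ B : Set (Fin n → ℝ), distribution volume (B.indicator 1) y =
      if y < 1 then volume B else 0 := by
    intro B
    rw [distribution]
    split_ifs with hy
    · congr 1
      ext x
      by_cases hx : x ∈ B <;> simp [hx, hy]
    · convert measure_empty (μ := volume)
      refine eq_empty_of_forall_notMem fun x hx => hy ?_
      exact lt_of_lt_of_le hx (indicator_one_le_one B x)
  rw [key, key, hAE]

lemma measurableSet_cubeVolume_lt (t : ℝ≥0∞) :
    MeasurableSet {x : Fin n → ℝ | ENNReal.ofReal (cubeVolume x) < t} :=
  measurableSet_lt (ENNReal.measurable_ofReal.comp measurable_cubeVolume) measurable_const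

lemma fundamentalFunction_eq (hn : 1 ≤ n) (X : QuasiBanachRISpace n) (t : ℝ≥0∞) :
    fundamentalFunction X.norm t =
      X.norm ({x : Fin n → ℝ | ENNReal.ofReal (cubeVolume x) < t}.indicator 1) := by
  rw [← fundamentalFunction_volume X (measurableSet_cubeVolume_lt t), volume_cubeVolume_lt hn]

lemma fundamentalFunction_mono (hn : 1 ≤ n) (X : QuasiBanachRISpace n) :
    Monotone (fundamentalFunction X.norm) := by
  intro s t hst
  rw [fundamentalFunction_eq hn, fundamentalFunction_eq hn]
  refine X.mono _ _ (measurable_one.indicator (measurableSet_cubeVolume_lt s))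
    (measurable_one.indicator (measurableSet_cubeVolume_lt t)) (ae_of_all _ fun x => ?_)
  exact indicator_le_indicator_of_subset (fun x (hx : _ < s) => hx.trans_le hst)
    (fun _ => zero_le) x

lemma fundamentalFunction_ne_zero (hn : 1 ≤ n) (X : QuasiBanachRISpace n) {t : ℝ≥0∞}
    (ht : t ≠ 0) : fundamentalFunction X.norm t ≠ 0 := by
  rw [fundamentalFunction_eq hn, Ne, X.norm_eq_zero_iff _
    (measurable_one.indicator (measurableSet_cubeVolume_lt t)),
    indicator_ae_eq_zero]
  simpa [volume_cubeVolume_lt hn] using ht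

lemma fundamentalFunction_ne_top (hn : 1 ≤ n) (X : QuasiBanachRISpace n) {t : ℝ≥0∞}
    (ht : t ≠ ∞) : fundamentalFunction X.norm t ≠ ∞ := by
  rw [fundamentalFunction_eq hn]
  refine (X.norm_indicator_lt_top _ (measurableSet_cubeVolume_lt t) ?_).ne
  rw [volume_cubeVolume_lt hn]
  exact ht.lt_top

lemma fundamentalFunction_le_half (hn : 1 ≤ n) (X : QuasiBanachRISpace n) {K : ℝ≥0}
    (hK : ∀ f g, Measurable f → Measurable g →
      X.norm (fun x => f x + g x) ≤ K * (X.norm f + X.norm g)) {t : ℝ≥0∞} (ht : t ≠ ∞) :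
    fundamentalFunction X.norm t ≤ 2 * K * fundamentalFunction X.norm (t / 2) := by
  set B := {x : Fin n → ℝ | ENNReal.ofReal (cubeVolume x) < t} with hB
  set A := {x : Fin n → ℝ | ENNReal.ofReal (cubeVolume x) < t / 2} with hA
  have hBm : MeasurableSet B := measurableSet_cubeVolume_lt t
  have hAm : MeasurableSet A := measurableSet_cubeVolume_lt (t / 2)
  have hAB : A ⊆ B := fun x (hx : _ < t / 2) => hx.trans_le ENNReal.half_le_self
  have hA2 : volume A = t / 2 := volume_cubeVolume_lt hn _
  have hD : volume (B \ A) = t / 2 := by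
    rw [measure_sdiff hAB hAm.nullMeasurableSet (by rw [hA2]; exact ENNReal.div_ne_top ht (by simp)),
      hA2, hB, volume_cubeVolume_lt hn, ENNReal.sub_half ht]
  have hsum : B.indicator (1 : (Fin n → ℝ) → ℝ≥0∞) =
      fun x => A.indicator 1 x + (B \ A).indicator 1 x := by
    funext x
    by_cases hxA : x ∈ A
    · simp [hxA, hAB hxA]
    · by_cases hxB : x ∈ B <;> simp [hxA, hxB]
  calc fundamentalFunction X.norm t = X.norm (B.indicator 1) := fundamentalFunction_eq hn X t
    _ ≤ K * (X.norm (A.indicator 1) + X.norm ((B \ A).indicator 1)) := by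
        rw [hsum]
        exact hK _ _ (measurable_one.indicator hAm) (measurable_one.indicator (hBm.diff hAm))
    _ = 2 * K * fundamentalFunction X.norm (t / 2) := by
        rw [← fundamentalFunction_volume X hAm, ← fundamentalFunction_volume X (hBm.diff hAm), hA2,
          hD]
        ring

/-! ### Extrapolation -/

/-- The weak type inequality for one weight and one level, without roots. -/
lemma rpow_mul_setLIntegral_le {p : ℝ} (hp : 1 ≤ p) {w f g : (Fin n → ℝ) → ℝ≥0∞}
    (hg : Measurable g) {A : ℝ≥0∞} (h : weakNorm p w g ≤ A * strongNorm p w f) {y : ℝ≥0}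
    (hy : 0 < y) :
    (y : ℝ≥0∞) ^ p * ∫⁻ x in {x | y < g x}, w x ≤ A ^ p * ∫⁻ x, f x ^ p * w x := by
  have hp0 : 0 < p := by linarith
  have h1 : (y : ℝ≥0∞) * distribution (volume.withDensity w) g y ^ (1 / p) ≤
      A * strongNorm p w f := le_trans (le_iSup₂_of_le (f := fun (y : ℝ≥0) (_ : 0 < y) =>
        (y : ℝ≥0∞) * distribution (volume.withDensity w) g y ^ (1 / p)) y hy le_rfl) h
  rw [distribution, withDensity_apply _ (measurableSet_lt measurable_const hg), strongNorm] at h1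
  have h2 := ENNReal.rpow_le_rpow h1 hp0.le
  rwa [ENNReal.mul_rpow_of_nonneg _ _ hp0.le, ENNReal.mul_rpow_of_nonneg _ _ hp0.le,
    ← ENNReal.rpow_mul, ← ENNReal.rpow_mul, one_div_mul_cancel hp0.ne', ENNReal.rpow_one,
    ENNReal.rpow_one] at h2

lemma le_of_rpow_mul_le {p : ℝ} (hp : 1 ≤ p) {y D q T L : ℝ≥0∞} (hD0 : D ≠ 0) (hD : D ≠ ∞)
    (hq0 : q ≠ 0) (hq : q ≠ ∞) (hT0 : T ≠ 0) (hT : T ≠ ∞)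
    (h : y ^ p * ((D * q) ^ (1 - p) * (T / 2)) ≤ L * (T * q)) :
    y ≤ (2 * L * D ^ (p - 1)) ^ (1 / p) * q := by
  have hp0 : 0 < p := by linarith
  have hinv : (D * q) ^ (1 - p) * (D * q) ^ (p - 1) = 1 := by
    rw [← ENNReal.rpow_add _ _ (mul_ne_zero hD0 hq0) (ENNReal.mul_ne_top hD hq)]
    simp
  have h1 : y ^ p * T ≤ (2 * L * D ^ (p - 1) * q ^ p) * T := by
    calc y ^ p * T
        = y ^ p * ((D * q) ^ (1 - p) * (T / 2)) * (2 * (D * q) ^ (p - 1)) := by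
          rw [show y ^ p * ((D * q) ^ (1 - p) * (T / 2)) * (2 * (D * q) ^ (p - 1)) =
            y ^ p * (T / 2 * 2) * ((D * q) ^ (1 - p) * (D * q) ^ (p - 1)) by ring, hinv,
            ENNReal.div_mul_cancel (by simp) (by simp), mul_one]
      _ ≤ L * (T * q) * (2 * (D * q) ^ (p - 1)) := by gcongr
      _ = (2 * L * D ^ (p - 1) * (q ^ (1 : ℝ) * q ^ (p - 1))) * T := by
          rw [ENNReal.mul_rpow_of_nonneg _ _ (by linarith : 0 ≤ p - 1), ENNReal.rpow_one]
          ring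
      _ = _ := by rw [← ENNReal.rpow_add _ _ hq0 hq, add_sub_cancel]
  have h2 : y ^ p ≤ 2 * L * D ^ (p - 1) * q ^ p := (ENNReal.mul_le_mul_iff_left hT0 hT).1 h1
  have h3 := ENNReal.rpow_le_rpow h2 (z := 1 / p) (by positivity)
  rwa [ENNReal.mul_rpow_of_nonneg _ _ (by positivity), ← ENNReal.rpow_mul, ← ENNReal.rpow_mul,
    mul_one_div_cancel hp0.ne', ENNReal.rpow_one, ENNReal.rpow_one] at h3

lemma rpow_mul_rpow_mul_le {p : ℝ} (hp : 1 ≤ p) {f u v : ℝ≥0∞} (hfu : f ≤ u) (hu0 : u ≠ 0)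
    (hu : u ≠ ∞) : f ^ p * (u ^ (1 - p) * v) ≤ f * v := by
  have hp' : 0 ≤ p - 1 := by linarith
  calc f ^ p * (u ^ (1 - p) * v) = f * f ^ (p - 1) * (u ^ (1 - p) * v) := by
        congr 1
        nth_rewrite 2 [← ENNReal.rpow_one f]
        rw [← ENNReal.rpow_add_of_nonneg _ _ one_pos.le hp', add_sub_cancel]
    _ ≤ f * u ^ (p - 1) * (u ^ (1 - p) * v) := by gcongr
    _ = f * v * (u ^ (p - 1) * u ^ (1 - p)) := by ring
    _ = f * v := by
        rw [← ENNReal.rpow_add _ _ hu0 hu]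
        simp

lemma ae_lt_top_of_marcinkiewiczNorm_lt_top (hn : 1 ≤ n) (X : QuasiBanachRISpace n)
    {u : (Fin n → ℝ) → ℝ≥0∞} (h : marcinkiewiczNorm X u < ∞) : ∀ᵐ x, u x < ∞ := by
  refine nonpos_iff_eq_zero.1 (ENNReal.le_of_forall_pos_le_add fun t ht _ => ?_)
  rw [zero_add]
  have h1 : fundamentalFunction X.norm t * decreasingRearrangement volume u t < ∞ :=
    lt_of_le_of_lt (le_iSup₂_of_le (f := fun (s : ℝ≥0) (_ : 0 < s) =>
      fundamentalFunction X.norm s * decreasingRearrangement volume u s) t ht le_rfl) h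
  have h2 : decreasingRearrangement volume u t < ∞ := by
    by_contra! hc
    rw [top_le_iff.1 hc, ENNReal.mul_top (fundamentalFunction_ne_zero hn X
      (ENNReal.coe_ne_zero.2 ht.ne'))] at h1
    exact lt_irrefl _ h1
  refine le_trans (measure_mono fun x hx => ?_)
    (distribution_le_of_decreasingRearrangement_le (ν := volume) (f := u) (t := t) le_rfl)
  exact h2.trans_le (not_lt.1 hx)

/-- A common `A₁` constant for `M_δ f` and `(M χ_E) ^ μ`. -/
noncomputable def extrapolationWeightConst (n : ℕ) (δ μ : ℝ) : ℝ≥0∞ :=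
  max (coifmanRochbergConst n δ) (coifmanRochbergConst n μ)

lemma extrapolationWeightConst_lt_top {δ μ : ℝ} (hδ0 : 0 < δ) (hδ1 : δ < 1) (hμ0 : 0 < μ)
    (hμ1 : μ < 1) : extrapolationWeightConst n δ μ < ∞ :=
  max_lt (coifmanRochbergConst_lt_top hδ0 hδ1) (coifmanRochbergConst_lt_top hμ0 hμ1)

/-- The heart of the matter: the weak type inequality is tested with the weight
`(M_δ f) ^ (1 - p) (M χ_E) ^ μ`, where `E ⊆ {g > y}` has finite measure greater than `s`. -/
lemma le_of_weakExtrapolationPair (hn : 1 ≤ n) (X : QuasiBanachRISpace n) {K C₁ C₂ C₃ : ℝ≥0}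
    (hK : ∀ f g, Measurable f → Measurable g →
      X.norm (fun x => f x + g x) ≤ K * (X.norm f + X.norm g))
    (h_i : ∀ t : ℝ≥0, 0 < t →
      fundamentalFunction (associateNorm X.norm) t ≤ C₁ * (t / fundamentalFunction X.norm t))
    {δ : ℝ} (hδ0 : 0 < δ) (hδ1 : δ < 1)
    (h_ii : ∀ f : (Fin n → ℝ) → ℝ≥0∞, Measurable f →
      marcinkiewiczNorm X (maximalPower δ f) ≤ C₂ * X.norm f)
    {μ : ℝ} (hμ0 : 0 < μ) (hμ1 : μ < 1)
    (h_iii : ∀ s : ℝ≥0, 0 < s →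
      representationNorm (associateNorm X.norm)
          (fun t : ℝ => ENNReal.ofReal (1 / (1 + t / s) ^ μ)) ≤
        C₃ * fundamentalFunction (associateNorm X.norm) s)
    {p : ℝ} (hp : 1 ≤ p) {φ : ℝ → ℝ≥0} {A : ℝ≥0}
    (hA : ∀ a, a ≤ extrapolationWeightConst n δ μ ^ p → φ a.toReal ≤ A)
    {f g : (Fin n → ℝ) → ℝ≥0∞} (hf : Measurable f) (hg : Measurable g)
    (hfg : WeakExtrapolationPair p φ f g) (h0 : X.norm f ≠ 0) (ht : X.norm f ≠ ∞)
    {s y : ℝ≥0} (hs : 0 < s) (hy : 0 < y) (hsy : s < distribution volume g y) :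
    y ≤ (2 * ((A : ℝ≥0∞) ^ p * ((5 ^ n + 1) ^ μ * C₃ * C₁)) * (2 * K * C₂ + 1) ^ (p - 1)) ^
      (1 / p) * (X.norm f / fundamentalFunction X.norm s) := by
  have hgy : MeasurableSet {x | (y : ℝ≥0∞) < g x} := measurableSet_lt measurable_const hg
  obtain ⟨E, hE, hEsub, hsE, hEt⟩ := Measure.exists_subset_measure_lt_top hgy hsy
  obtain ⟨T, hT⟩ : ∃ T : ℝ≥0, volume E = T :=
    ⟨(volume E).toNNReal, (ENNReal.coe_toNNReal hEt.ne).symm⟩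
  rw [hT] at hsE
  have hsT : s < T := ENNReal.coe_lt_coe.1 hsE
  have hT0 : 0 < T := hs.trans hsT
  have hT0' : (T : ℝ≥0∞) ≠ 0 := ENNReal.coe_ne_zero.2 hT0.ne'
  set N := X.norm f with hN
  set Φ := fundamentalFunction X.norm T with hΦ
  have hΦ0 : Φ ≠ 0 := fundamentalFunction_ne_zero hn X hT0'
  have hΦt : Φ ≠ ∞ := fundamentalFunction_ne_top hn X ENNReal.coe_ne_top
  set q := N / Φ with hq
  have hq0 : q ≠ 0 := (ENNReal.div_pos h0 hΦt).ne'
  have hqt : q ≠ ∞ := ENNReal.div_ne_top ht hΦ0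
  set D : ℝ≥0∞ := 2 * K * C₂ + 1 with hD
  have hD0 : D ≠ 0 := by simp [hD]
  have hDt : D ≠ ∞ := by rw [hD]; finiteness
  set C₀ := extrapolationWeightConst n δ μ with hC₀
  have hC₀t : C₀ ≠ ∞ := (extrapolationWeightConst_lt_top hδ0 hδ1 hμ0 hμ1).ne
  have hC₀0 : C₀ ≠ 0 :=
    (one_pos.trans_le ((one_le_coifmanRochbergConst δ).trans (le_max_left _ _))).ne'
  -- The two `A₁` weights.
  set u : (Fin n → ℝ) → ℝ≥0∞ := maximalPower δ f with hu
  set v : (Fin n → ℝ) → ℝ≥0∞ := fun x => maximalFunction (E.indicator 1) x ^ μ with hv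
  have hfδ : Measurable fun x => f x ^ (1 / δ) := hf.pow_const _
  have hEm : Measurable (E.indicator (1 : (Fin n → ℝ) → ℝ≥0∞)) := measurable_one.indicator hE
  have hum : Measurable u := (measurable_maximalFunction _).pow_const δ
  have hvm : Measurable v := (measurable_maximalFunction _).pow_const μ
  have hf0 : ¬ f =ᵐ[volume] 0 := fun h => h0 ((X.norm_eq_zero_iff f hf).2 h)
  have hu0 : ∀ x, 0 < u x := fun x => by
    refine ENNReal.rpow_pos_of_nonneg (maximalFunction_pos hfδ (fun h => hf0 ?_) x) hδ0.le
    filter_upwards [h] with x hx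
    simpa [hδ0, hδ0.le, hδ0.not_gt] using hx
  have hut : ∀ᵐ x, u x < ∞ := ae_lt_top_of_marcinkiewiczNorm_lt_top hn X
    ((h_ii f hf).trans_lt (ENNReal.mul_lt_top ENNReal.coe_lt_top ht.lt_top))
  have hv0 : ∀ x, 0 < v x := fun x => by
    refine ENNReal.rpow_pos_of_nonneg (maximalFunction_pos hEm ?_ x) hμ0.le
    rw [indicator_ae_eq_zero]
    simpa [hT] using hT0.ne'
  have hv1 : ∀ x, v x ≤ 1 := fun x =>
    ENNReal.rpow_le_one (maximalFunction_le_one (indicator_one_le_one E) x) hμ0.le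
  have hMu : ∀ x, maximalFunction u x ≤ C₀ * u x := fun x =>
    (maximalFunction_rpow_maximalFunction_le hn hδ0 hδ1 hfδ x).trans
      (mul_le_mul_left (le_max_left _ _) _)
  have hMv : ∀ x, maximalFunction v x ≤ C₀ * v x := fun x =>
    (maximalFunction_rpow_maximalFunction_le hn hμ0 hμ1 hEm x).trans
      (mul_le_mul_left (le_max_right _ _) _)
  obtain ⟨hw, hwC⟩ := isMuckenhoupt_rpow_mul hp hC₀0 hC₀t hum hvm hu0 hut hv0 hv1 hMu hMv
  have hfu : ∀ᵐ x, f x ≤ u x := by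
    filter_upwards [ae_le_maximalFunction hfδ] with x hx
    have := ENNReal.rpow_le_rpow hx hδ0.le
    rwa [← ENNReal.rpow_mul, one_div_mul_cancel hδ0.ne', ENNReal.rpow_one] at this
  have hvE : ∀ᵐ x, x ∈ E → 1 ≤ v x := by
    filter_upwards [ae_le_maximalFunction hEm] with x hx hxE
    rw [indicator_of_mem hxE, Pi.one_apply] at hx
    exact ENNReal.one_le_rpow hx hμ0
  -- At the level `D q` the set `{M_δ f > D q}` covers at most half of `E`.
  have hlevel : distribution volume u (D * q) ≤ T / 2 := by
    refine distribution_le_of_decreasingRearrangement_le ?_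
    have hτ : 0 < T / 2 := by positivity
    have h1 : fundamentalFunction X.norm (T / 2 : ℝ≥0) *
        decreasingRearrangement volume u (T / 2 : ℝ≥0) ≤ C₂ * N :=
      le_trans (le_iSup₂_of_le (f := fun (s : ℝ≥0) (_ : 0 < s) =>
        fundamentalFunction X.norm s * decreasingRearrangement volume u s) (T / 2) hτ le_rfl)
        (h_ii f hf)
    rw [ENNReal.coe_div (by simp), ENNReal.coe_ofNat] at h1
    rw [hq, ← mul_div_assoc, ENNReal.le_div_iff_mul_le (Or.inl hΦ0) (Or.inl hΦt), mul_comm]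
    calc Φ * decreasingRearrangement volume u (T / 2)
        ≤ 2 * K * fundamentalFunction X.norm (T / 2) * decreasingRearrangement volume u (T / 2) := by
          gcongr
          exact fundamentalFunction_le_half hn X hK ENNReal.coe_ne_top
      _ = 2 * K * (fundamentalFunction X.norm (T / 2) *
            decreasingRearrangement volume u (T / 2)) := by ring
      _ ≤ 2 * K * (C₂ * N) := by gcongr
      _ = 2 * K * C₂ * N := by ring
      _ ≤ D * N := by gcongr; exact le_self_add
  have hum' : MeasurableSet {x | D * q < u x} := measurableSet_lt measurable_const hum
  have hhalf : (T : ℝ≥0∞) / 2 ≤ volume (E \ {x | D * q < u x}) := by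
    have h1 : (T : ℝ≥0∞) ≤ volume (E \ {x | D * q < u x}) + T / 2 := by
      calc (T : ℝ≥0∞) = volume E := hT.symm
        _ ≤ volume ((E \ {x | D * q < u x}) ∪ {x | D * q < u x}) := measure_mono (by simp)
        _ ≤ _ := (measure_union_le _ _).trans (by gcongr; exact hlevel)
    calc (T : ℝ≥0∞) / 2 = T - T / 2 := (ENNReal.sub_half ENNReal.coe_ne_top).symm
      _ ≤ _ := tsub_le_iff_right.2 h1
  have hlower : (D * q) ^ (1 - p) * (T / 2) ≤
      ∫⁻ x in {x | (y : ℝ≥0∞) < g x}, u x ^ (1 - p) * v x := by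
    calc (D * q) ^ (1 - p) * (T / 2)
        ≤ (D * q) ^ (1 - p) * volume (E \ {x | D * q < u x}) := by gcongr
      _ = ∫⁻ _ in E \ {x | D * q < u x}, (D * q) ^ (1 - p) := (setLIntegral_const _ _).symm
      _ ≤ ∫⁻ x in E \ {x | D * q < u x}, u x ^ (1 - p) * v x := by
          refine setLIntegral_mono_ae' (hE.diff hum') ?_
          filter_upwards [hvE] with x hx hxE
          have h1 : u x ≤ D * q := not_lt.1 hxE.2
          calc (D * q) ^ (1 - p) ≤ u x ^ (1 - p) :=
                rpow_le_rpow_of_exponent_nonpos (by linarith) h1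
            _ ≤ u x ^ (1 - p) * v x := le_mul_of_one_le_right' (hx hxE.1)
      _ ≤ _ := lintegral_mono_set (sdiff_subset.trans hEsub)
  have hupper : ∫⁻ x, f x ^ p * (u x ^ (1 - p) * v x) ≤ (5 ^ n + 1) ^ μ * C₃ * C₁ * (T * q) := by
    have hanti : AntitoneOn (fun t : ℝ => ENNReal.ofReal (1 / (1 + t / T) ^ μ)) (Ici 0) := by
      intro a ha b _ hab
      have ha' : (0 : ℝ) ≤ a := ha
      refine ENNReal.ofReal_le_ofReal ?_
      gcongr
    calc ∫⁻ x, f x ^ p * (u x ^ (1 - p) * v x) ≤ ∫⁻ x, f x * v x := by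
          refine lintegral_mono_ae ?_
          filter_upwards [hfu, hut] with x hx hx'
          exact rpow_mul_rpow_mul_le hp hx (hu0 x).ne' hx'.ne
      _ ≤ (5 ^ n + 1) ^ μ * representationNorm (n := n) (associateNorm X.norm)
            (fun t : ℝ => ENNReal.ofReal (1 / (1 + t / T) ^ μ)) * N :=
          lintegral_mul_le_representationNorm hn X hf hvm h0 ht (by fun_prop) hanti
            (distribution_maximalFunction_indicator_rpow_le hn hE hT0 hT hμ0)
      _ ≤ (5 ^ n + 1) ^ μ * (C₃ * (C₁ * (T / Φ))) * N := by
          gcongr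
          exact (h_iii T hT0).trans (by gcongr; exact h_i T hT0)
      _ = (5 ^ n + 1) ^ μ * C₃ * C₁ * (T * q) := by
          rw [hq, div_eq_mul_inv, div_eq_mul_inv]
          ring
  have hweak := rpow_mul_setLIntegral_le hp hg ((hfg _ hw).trans
    (mul_le_mul_left (ENNReal.coe_le_coe.2 (hA _ hwC)) _)) hy
  have hfinal : (y : ℝ≥0∞) ^ p * ((D * q) ^ (1 - p) * (T / 2)) ≤
      (A : ℝ≥0∞) ^ p * ((5 ^ n + 1) ^ μ * C₃ * C₁) * (T * q) := by
    calc _ ≤ (y : ℝ≥0∞) ^ p * ∫⁻ x in {x | (y : ℝ≥0∞) < g x}, u x ^ (1 - p) * v x := by gcongr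
      _ ≤ (A : ℝ≥0∞) ^ p * ∫⁻ x, f x ^ p * (u x ^ (1 - p) * v x) := hweak
      _ ≤ (A : ℝ≥0∞) ^ p * ((5 ^ n + 1) ^ μ * C₃ * C₁ * (T * q)) := by gcongr
      _ = _ := by ring
  refine (le_of_rpow_mul_le hp hD0 hDt hq0 hqt hT0' ENNReal.coe_ne_top hfinal).trans ?_
  gcongr _ * ?_
  exact ENNReal.div_le_div_left (fundamentalFunction_mono hn X (ENNReal.coe_le_coe.2 hsT.le)) _

/-- For `f = 0` the constant weight suffices. -/
lemma distribution_eq_zero_of_weakExtrapolationPair {p : ℝ} (hp : 1 ≤ p) {φ : ℝ → ℝ≥0}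
    {f g : (Fin n → ℝ) → ℝ≥0∞} (hg : Measurable g) (hfg : WeakExtrapolationPair p φ f g)
    (hf0 : f =ᵐ[volume] 0) {y : ℝ≥0} (hy : 0 < y) : distribution volume g y = 0 := by
  have hp0 : 0 < p := by linarith
  have hM : ∀ x : Fin n → ℝ, maximalFunction (fun _ : Fin n → ℝ => (1 : ℝ≥0∞)) x ≤ 1 * 1 :=
    fun x =>
    (maximalFunction_le_one (fun _ => le_rfl) x).trans (one_mul _).ge
  have hw := (isMuckenhoupt_rpow_mul hp one_ne_zero ENNReal.one_ne_top measurable_const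
    measurable_const (fun _ => one_pos) (ae_of_all _ fun _ => ENNReal.one_lt_top)
    (fun _ => one_pos) (fun _ => le_rfl) hM hM).1
  have h1 := rpow_mul_setLIntegral_le hp hg (hfg _ hw) hy
  have h2 : ∫⁻ x, f x ^ p * ((1 : ℝ≥0∞) ^ (1 - p) * 1) = 0 := by
    rw [lintegral_congr_ae (g := fun _ => 0), lintegral_zero]
    filter_upwards [hf0] with x hx
    simp [hx, hp0]
  rw [h2, mul_zero, nonpos_iff_eq_zero, mul_eq_zero] at h1
  rcases h1 with h1 | h1
  · rw [ENNReal.rpow_eq_zero_iff_of_pos hp0] at h1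
    exact absurd (ENNReal.coe_eq_zero.1 h1) hy.ne'
  · simpa [distribution] using h1

end RIExtrapolation

open RIExtrapolation in
theorem theorem3p17 (n : ℕ) (hn : 1 ≤ n) (X : QuasiBanachRISpace n)
    (h_i : ∃ C : ℝ≥0, ∀ t : ℝ≥0, 0 < t →
      fundamentalFunction (associateNorm X.norm) t ≤ C * (t / fundamentalFunction X.norm t))
    (h_ii : ∃ δ : ℝ, 0 < δ ∧ δ < 1 ∧ ∃ C : ℝ≥0, ∀ f : (Fin n → ℝ) → ℝ≥0∞, Measurable f →
      marcinkiewiczNorm X (maximalPower δ f) ≤ C * X.norm f)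
    (h_iii : ∃ μ : ℝ, 0 < μ ∧ μ < 1 ∧ ∃ C : ℝ≥0, ∀ s : ℝ≥0, 0 < s →
      representationNorm (associateNorm X.norm)
          (fun t : ℝ => ENNReal.ofReal (1 / (1 + t / s) ^ μ)) ≤
        C * fundamentalFunction (associateNorm X.norm) s)
    (p₀ : ℝ) (hp₀ : 1 ≤ p₀) (φ : ℝ → ℝ≥0)
    (hφ : ∀ B : ℝ, ∃ C : ℝ≥0, ∀ t : ℝ, 0 < t → t < B → φ t ≤ C) :
    ∃ C : ℝ≥0, ∀ f g : (Fin n → ℝ) → ℝ≥0∞, Measurable f → Measurable g →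
      WeakExtrapolationPair p₀ φ f g →
      marcinkiewiczNorm X g ≤ C * X.norm f := by
  obtain ⟨K, hK⟩ := X.quasi_triangle
  obtain ⟨C₁, h_i⟩ := h_i
  obtain ⟨δ, hδ0, hδ1, C₂, h_ii⟩ := h_ii
  obtain ⟨μ, hμ0, hμ1, C₃, h_iii⟩ := h_iii
  have hp : 0 < p₀ := by linarith
  have hC₀ : extrapolationWeightConst n δ μ ^ p₀ ≠ ∞ := ENNReal.rpow_ne_top_of_nonneg hp.le
    (extrapolationWeightConst_lt_top hδ0 hδ1 hμ0 hμ1).ne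
  obtain ⟨A, hA⟩ := hφ ((extrapolationWeightConst n δ μ ^ p₀).toReal + 1)
  -- `φ` is controlled on `(0, B)` only, so the value `φ 0` enters the bound separately.
  have hA' : ∀ a, a ≤ extrapolationWeightConst n δ μ ^ p₀ → φ a.toReal ≤ max A (φ 0) := by
    intro a ha
    rcases (ENNReal.toReal_nonneg (a := a)).eq_or_lt with h | h
    · rw [← h]
      exact le_max_right _ _
    · refine (hA _ h ?_).trans (le_max_left _ _)
      linarith [ENNReal.toReal_mono hC₀ ha]
  set B : ℝ≥0∞ := (2 * (((max A (φ 0) : ℝ≥0) : ℝ≥0∞) ^ p₀ * ((5 ^ n + 1) ^ μ * C₃ * C₁)) *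
    (2 * K * C₂ + 1) ^ (p₀ - 1)) ^ (1 / p₀) with hB
  have hBt : B ≠ ∞ := by
    have h1 : (((max A (φ 0) : ℝ≥0) : ℝ≥0∞)) ^ p₀ ≠ ∞ :=
      ENNReal.rpow_ne_top_of_nonneg hp.le ENNReal.coe_ne_top
    have h2 : ((5 : ℝ≥0∞) ^ n + 1) ^ μ ≠ ∞ :=
      ENNReal.rpow_ne_top_of_nonneg hμ0.le (by finiteness)
    have h3 : (2 * K * C₂ + 1 : ℝ≥0∞) ^ (p₀ - 1) ≠ ∞ :=
      ENNReal.rpow_ne_top_of_nonneg (by linarith) (by finiteness)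
    exact ENNReal.rpow_ne_top_of_nonneg (by positivity) (by finiteness)
  -- The summand `1` makes the constant positive, for the case `‖f‖ = ∞`.
  refine ⟨B.toNNReal + 1, fun f g hf hg hfg => ?_⟩
  rw [ENNReal.coe_add, ENNReal.coe_toNNReal hBt, ENNReal.coe_one]
  rcases eq_or_ne (X.norm f) ∞ with ht | ht
  · rw [ht, ENNReal.mul_top (by simp)]
    exact le_top
  refine iSup_le fun s => iSup_le fun hs => ?_
  have hs0 : (s : ℝ≥0∞) ≠ 0 := ENNReal.coe_ne_zero.2 hs.ne'
  have hΦ0 := fundamentalFunction_ne_zero hn X hs0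
  have hΦt := fundamentalFunction_ne_top hn X (ENNReal.coe_ne_top (r := s))
  rw [mul_comm, ← ENNReal.le_div_iff_mul_le (Or.inl hΦ0) (Or.inl hΦt)]
  refine le_of_forall_lt_imp_le_of_dense fun z hz => ?_
  lift z to ℝ≥0 using hz.ne_top
  rcases eq_or_ne z 0 with rfl | hz0
  · exact zero_le
  have hz0 : 0 < z := pos_iff_ne_zero.2 hz0
  rw [lt_decreasingRearrangement_iff] at hz
  rcases eq_or_ne (X.norm f) 0 with h0 | h0
  · rw [distribution_eq_zero_of_weakExtrapolationPair hp₀ hg hfg ((X.norm_eq_zero_iff f hf).1 h0)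
      hz0] at hz
    exact absurd hz not_lt_zero
  · refine (le_of_weakExtrapolationPair hn X hK h_i hδ0 hδ1 h_ii hμ0 hμ1 h_iii hp₀ hA' hf hg hfg
      h0 ht hs hz0 hz).trans ?_
    rw [← hB, mul_div_assoc]
    gcongr
    exact le_self_add
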